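/- Let $d\in\mathbb N$ and let $P\in\mathbb R^{d\times d}$ be symmetric with $P\neq 0$. For $Q\in\mathbb R^{d\times d}$ symmetric put $\Phi_Q(t)=e^{i\pi Qt\cdot t}$, let $\mathcal F f(\xi)=\hat f(\xi)=\int_{\mathbb R^d} f(x)e^{-2\pi i \xi\cdot x}\,dx$ be the Fourier transform, extended unitarily to $L^2(\mathbb R^d)$, and let $$\mathfrak m_P f=\mathcal F^{-1}(\Phi_{-P}\hat f),\qquad f\in L^2(\mathbb R^d).$$ For $x\in\mathbb R^d$ write $x=x_1+x_2$ with $x_1\in\ker(P)^\perp$ and $x_2\in\ker(P)$. Let $M,N\in\mathbb R^{d\times d}$ be symmetric positive semidefinite matrices with $\ker(M)=\ker(N)=\ker(P)$, and let $f\in L^2(\mathbb R^d)\setminus\{0\}$. Suppose that there are measurable functions $\alpha,\beta:\ker(P)\to[0,\infty]$, finite almost everywhere with respect to Lebesgue measure on the Euclidean space $\ker(P)$, such that $$|f(x)|\le \alpha(x_2)e^{-\pi Mx\cdot x}\quad\text{for a.e. }x\in\mathbb R^d,\qquad |\mathfrak m_Pf(\xi)|\le \beta(\xi_2)e^{-\pi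 N\xi\cdot \xi}\quad\text{for a.e. }\xi\in\mathbb R^d.$$ Then: (i) Every positive eigenvalue $\lambda$ of $MPNP$ satisfies $\lambda\le 1$. (ii) If every positive eigenvalue of $MPNP$ equals $1$, then there is $\gamma\in L^2(\ker(P))$ such that $$f(x)=\gamma(x_2)e^{-\pi(M+iP^+)x\cdot x}\qquad\text{for a.e. }x\in\mathbb R^d,$$ where $P^+$ denotes the Moore--Penrose inverse of $P$. -/

import Mathlib

open MeasureTheory FourierTransform
open scoped ENNReal

/-- Euclidean space `ℝ^d`, with the Euclidean norm and Lebesgue measure. -/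
abbrev Euc (d : ℕ) : Type := EuclideanSpace ℝ (Fin d)

/-- The Hilbert space `L²(ℝ^d)` of (classes of) complex-valued functions. -/
noncomputable abbrev L2Euc (d : ℕ) := Lp (α := Euc d) ℂ 2 volume

/-- The quadratic form `A x · x`. -/
noncomputable def quadForm {d : ℕ} (A : Matrix (Fin d) (Fin d) ℝ) (x : Euc d) : ℝ :=
  inner ℝ (Matrix.toEuclideanLin A x) x

/-- The kernel of a matrix, as a subspace of `ℝ^d`. -/
noncomputable def matKer {d : ℕ} (A : Matrix (Fin d) (Fin d) ℝ) : Submodule ℝ (Euc d) :=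
  LinearMap.ker (Matrix.toEuclideanLin A)

/-- The chirp `Φ_Q(t) = e^{iπ Qt·t}`. -/
noncomputable def chirp {d : ℕ} (Q : Matrix (Fin d) (Fin d) ℝ) (t : Euc d) : ℂ :=
  Complex.exp (Complex.I * Real.pi * (quadForm Q t : ℂ))

theorem continuous_quadForm {d : ℕ} (A : Matrix (Fin d) (Fin d) ℝ) :
    Continuous (quadForm A) := by
  unfold quadForm
  exact (LinearMap.continuous_of_finiteDimensional _).inner continuous_id

theorem continuous_chirp {d : ℕ} (Q : Matrix (Fin d) (Fin d) ℝ) : Continuous (chirp Q) := by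
  unfold chirp
  have := continuous_quadForm Q
  fun_prop

theorem norm_chirp {d : ℕ} (Q : Matrix (Fin d) (Fin d) ℝ) (t : Euc d) : ‖chirp Q t‖ = 1 := by
  unfold chirp
  rw [mul_assoc, mul_comm, ← Complex.ofReal_mul, Complex.norm_exp_ofReal_mul_I]

theorem memLp_chirp_mul {d : ℕ} (Q : Matrix (Fin d) (Fin d) ℝ) (g : L2Euc d) :
    MemLp (fun t => chirp Q t * g t) 2 (volume : Measure (Euc d)) := by
  refine MemLp.of_le (Lp.memLp g)
    ((continuous_chirp Q).aestronglyMeasurable.mul (Lp.aestronglyMeasurable g)) ?_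
  exact Filter.Eventually.of_forall fun t => by simp [norm_chirp]

/-- The metaplectic multiplier `𝔪_P f = 𝓕⁻¹(Φ_{-P} 𝓕 f)` on `L²(ℝ^d)`. -/
noncomputable def metMultiplier {d : ℕ} (P : Matrix (Fin d) (Fin d) ℝ) (f : L2Euc d) : L2Euc d :=
  𝓕⁻ ((memLp_chirp_mul (-P) (𝓕 f)).toLp : L2Euc d)

/-- The four Penrose equations: `X` is the Moore-Penrose inverse of the real matrix `A`. -/
structure IsMoorePenrose {m n : Type*} [Fintype m] [Fintype n]
    (A : Matrix m n ℝ) (X : Matrix n m ℝ) : Prop where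
  mul_mul_self : A * X * A = A
  mul_mul_inv : X * A * X = X
  symm_left : (A * X).transpose = A * X
  symm_right : (X * A).transpose = X * A

theorem exists_isMoorePenrose {m n : Type*} [Fintype m] [Fintype n]
    (A : Matrix m n ℝ) : ∃ X : Matrix n m ℝ, IsMoorePenrose A X := by
  classical
  obtain ⟨G, hG1, hG2, hG3, hG4⟩ : ∃ G : Matrix n n ℝ,
      (A.transpose * A) * G * (A.transpose * A) = A.transpose * A ∧
      G * (A.transpose * A) * G = G ∧ G.transpose = G ∧
      (A.transpose * A) * G = G * (A.transpose * A) := by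
    obtain ⟨U, a, hUU, hs⟩ : ∃ (U : Matrix n n ℝ) (a : n → ℝ), U.transpose * U = 1 ∧
        A.transpose * A = U * Matrix.diagonal a * U.transpose := by
      have hH : (A.transpose * A).IsHermitian := by
        simpa using Matrix.isHermitian_conjTranspose_mul_self A
      refine ⟨hH.eigenvectorUnitary, hH.eigenvalues, ?_, ?_⟩
      · have := Unitary.coe_star_mul_self hH.eigenvectorUnitary
        simpa [Matrix.star_eq_conjTranspose] using this
      · conv_lhs => rw [hH.spectral_theorem]
        rw [Unitary.conjStarAlgAut_apply]
        simp [Matrix.star_eq_conjTranspose]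
    have key : ∀ a b : n → ℝ, (U * Matrix.diagonal a * U.transpose) *
        (U * Matrix.diagonal b * U.transpose) =
        U * Matrix.diagonal (fun i => a i * b i) * U.transpose := by
      intro a b
      calc _ = U * Matrix.diagonal a * (U.transpose * U) * Matrix.diagonal b * U.transpose := by
            simp only [Matrix.mul_assoc]
        _ = _ := by
            rw [hUU, Matrix.mul_one, Matrix.mul_assoc U, Matrix.diagonal_mul_diagonal]
    refine ⟨U * Matrix.diagonal (fun i => (a i)⁻¹) * U.transpose, ?_, ?_, ?_, ?_⟩
    · rw [hs, key, key]
      simp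
    · rw [hs, key, key]
      congr 3
      ext i
      by_cases h : a i = 0 <;> simp [h]
    · simp [Matrix.transpose_mul, Matrix.mul_assoc]
    · rw [hs, key, key]
      congr 3
      ext i
      ring
  refine ⟨G * A.transpose, ?_, ?_, ?_, ?_⟩
  · have h0 : (A * G * (A.transpose * A) - A).conjTranspose *
        (A * G * (A.transpose * A) - A) = 0 := by
      have e : (A * G * (A.transpose * A) - A).conjTranspose =
          (A.transpose * A) * G * A.transpose - A.transpose := by
        simp [Matrix.transpose_mul, hG3, Matrix.mul_assoc]
      rw [e, Matrix.sub_mul, Matrix.mul_sub, Matrix.mul_sub]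
      have e1 : A.transpose * A * G * A.transpose * (A * G * (A.transpose * A)) =
          A.transpose * A * G * (A.transpose * A) * G * (A.transpose * A) := by
        simp only [Matrix.mul_assoc]
      have e2 : A.transpose * A * G * A.transpose * A =
          A.transpose * A * G * (A.transpose * A) := by simp only [Matrix.mul_assoc]
      have e3 : A.transpose * (A * G * (A.transpose * A)) =
          A.transpose * A * G * (A.transpose * A) := by simp only [Matrix.mul_assoc]
      rw [e1, e2, e3, hG1, hG1]
      simp
    have h1 := Matrix.conjTranspose_mul_self_eq_zero.mp h0
    have h2 := sub_eq_zero.mp h1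
    simpa only [Matrix.mul_assoc] using h2
  · calc _ = (G * (A.transpose * A) * G) * A.transpose := by simp only [Matrix.mul_assoc]
      _ = _ := by rw [hG2]
  · simp [Matrix.transpose_mul, hG3, Matrix.mul_assoc]
  · rw [Matrix.mul_assoc, Matrix.transpose_mul, hG3, ← hG4]
    simp [Matrix.transpose_mul]

theorem IsMoorePenrose.unique {m n : Type*} [Fintype m] [Fintype n]
    {A : Matrix m n ℝ} {X Y : Matrix n m ℝ} (hX : IsMoorePenrose A X) (hY : IsMoorePenrose A Y) :
    X = Y := by
  have h1 : A * X = A * Y := by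
    calc A * X = (A * X).transpose := hX.symm_left.symm
      _ = ((A * Y) * (A * X)).transpose := by rw [← Matrix.mul_assoc, hY.mul_mul_self]
      _ = (A * X) * (A * Y) := by rw [Matrix.transpose_mul, hX.symm_left, hY.symm_left]
      _ = A * Y := by rw [← Matrix.mul_assoc, hX.mul_mul_self]
  have h2 : X * A = Y * A := by
    calc X * A = (X * A).transpose := hX.symm_right.symm
      _ = ((X * A) * (Y * A)).transpose := by
          rw [Matrix.mul_assoc, ← Matrix.mul_assoc A, hY.mul_mul_self]
      _ = (Y * A) * (X * A) := by rw [Matrix.transpose_mul, hX.symm_right, hY.symm_right]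
      _ = Y * A := by rw [Matrix.mul_assoc, ← Matrix.mul_assoc A, hX.mul_mul_self]
  calc X = X * A * X := hX.mul_mul_inv.symm
    _ = Y * A * Y := by rw [h2, Matrix.mul_assoc, h1, Matrix.mul_assoc]
    _ = Y := hY.mul_mul_inv

/-- The Moore-Penrose inverse `A⁺` of a real matrix. -/
noncomputable def moorePenrose {m n : Type*} [Fintype m] [Fintype n]
    (A : Matrix m n ℝ) : Matrix n m ℝ :=
  Classical.choose (exists_isMoorePenrose A)

theorem isMoorePenrose_moorePenrose {m n : Type*} [Fintype m] [Fintype n]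
    (A : Matrix m n ℝ) : IsMoorePenrose A (moorePenrose A) :=
  Classical.choose_spec (exists_isMoorePenrose A)

/-- The directional Gaussian bound `|g(x)| ≤ α(x₂) e^{-π Mx·x}` for almost every `x`, where `x₂` is
the orthogonal projection of `x` onto the subspace `K` and `α` is some measurable, almost everywhere
finite function on `K` (with respect to the Lebesgue measure of the Euclidean space `K`). -/
def DirectionalGaussianBound {d : ℕ} (K : Submodule ℝ (Euc d))
    (M : Matrix (Fin d) (Fin d) ℝ) (g : Euc d → ℂ) : Prop :=
  ∃ α : K → ℝ≥0∞, AEMeasurable α (volume : Measure K) ∧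
    (∀ᵐ z ∂(volume : Measure K), α z < ∞) ∧
    ∀ᵐ x ∂(volume : Measure (Euc d)),
      ‖g x‖ₑ ≤ α (K.orthogonalProjectionOnto x) *
        ENNReal.ofReal (Real.exp (-Real.pi * quadForm M x))

/-! Suppose first that `P` is invertible. The symbol `e^{-iπ Pξ·ξ}` has a multiple of `e^{iπ
P⁻¹x·x}` as convolution kernel. Expanding the square gives `𝔪_P f(x) = c e^{iπ P⁻¹x·x} 𝓕g(P⁻¹x)`
with `g(y) = e^{iπ P⁻¹y·y} f(y)`. At `x = Pζ` the two hypotheses become `|g| ≤ C e^{-π My·y}` and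
`|𝓕g(ζ)| ≤ C' e^{-π Bζ·ζ}` with `B = PNP`. This is the setting of Hardy's uncertainty principle for
the pair `M`, `B`.

Hardy's principle is proved on lines. The decay of `g` makes `z ↦ 𝓕g(ξ + z Mu)` entire, of growth
`e^{π (Mu·u)(Im z)²}`. If it decays at the same rate on the real axis, Phragmén–Lindelöf and
Liouville force it to be a Gaussian (`fourier_line_eq_gaussian`). When `BMu = lu` with `l > 1`, the
actual decay beats that Gaussian, so `𝓕g` vanishes on every line parallel to `Mu`
(`ae_eq_zero_of_hardy`). When `BM = 1`, the lines through the origin show that `𝓕g`, and hence `g`,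
is Gaussian (`ae_eq_gaussian_of_hardy`).

If `P` has a kernel `K`, the multiplier acts only in the directions of `Kᗮ`, where `P` is invertible
with inverse `P⁺`, so the argument applies to almost every slice `f(z + ·)`, `z ∈ K`. The kernel
formula on slices is obtained weakly. Pairing with `χ ⊗ φ` moves the multiplier onto an explicit
chirped Gaussian `φ` (`integral_orthogonalTensor_metMultiplier`), varying `χ` isolates a slice
(`ae_slice_pairing_eq`), and varying the frequency of `φ` recovers the formula through injectivity
of the Fourier transform (`ae_eq_fourier_comp_of_pairing`). -/

/-! ### Entire functions of order two. -/

/-- Phragmén–Lindelöf in the open first quadrant at the critical order two, for a function whose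
growth is controlled by the real part. -/
theorem norm_le_of_quadrant {H : ℂ → ℂ} (hH : Differentiable ℂ H) {a C : ℝ} (ha : 0 < a)
    (hgrow : ∀ z : ℂ, ‖H z‖ ≤ C * Real.exp (a * z.re ^ 2)) (hreal : ∀ x : ℝ, ‖H x‖ ≤ C)
    {z : ℂ} (hre : 0 < z.re) (him : 0 < z.im) : ‖H z‖ ≤ C := by
  have hC : 0 ≤ C := (norm_nonneg _).trans (hreal 0)
  have hz0 : z ≠ 0 := by rintro rfl; simp at hre
  set θ := z.arg with hθ
  have hθ0 : 0 ≤ θ := Complex.arg_nonneg_iff.2 him.le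
  have hθ1 : θ < Real.pi / 2 := Complex.arg_lt_pi_div_two_iff.2 (Or.inl hre)
  -- the estimate in the sector of opening `φ`
  have key : ∀ φ : ℝ, θ < φ → φ < Real.pi / 2 →
      ‖H z * Complex.exp (Complex.I * (a / 2 * (Real.cos φ / Real.sin φ) : ℝ) * z ^ 2)‖ ≤ C := by
    intro φ h1 h2
    have hφ0 : 0 < φ := hθ0.trans_lt h1
    have hsin : 0 < Real.sin φ := Real.sin_pos_of_pos_of_lt_pi hφ0 (by linarith [Real.pi_pos])
    have hcos : 0 < Real.cos φ := Real.cos_pos_of_mem_Ioo ⟨by linarith, h2⟩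
    -- Since `|e^{iσz²}| = e^{-2σxy}`, this `σ` cancels the growth `e^{ax²}` exactly on the ray of
    -- angle `φ`. It tends to `0` as `φ → π/2`, so the extra factor disappears in the limit.
    set σ : ℝ := a / 2 * (Real.cos φ / Real.sin φ) with hσ
    have hσ0 : 0 < σ := by positivity
    have hnorm : ∀ z : ℂ, ‖H z * Complex.exp (Complex.I * (σ : ℝ) * z ^ 2)‖ =
        ‖H z‖ * Real.exp (-2 * σ * z.re * z.im) := by
      intro z
      rw [norm_mul, Complex.norm_exp]
      congr 2
      simp [pow_two]
      ring
    have hexp : z = Complex.exp (Complex.log z) := (Complex.exp_log hz0).symm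
    rw [hexp]
    have him_log : (Complex.log z).im = θ := Complex.log_im z
    -- In the coordinate `log z` the sector is a strip of width `φ`, and order two in `z` becomes
    -- growth `exp(a e^{2|Re w|})`. This is admissible because `2 < π/φ`; the quadrant itself would
    -- be the borderline case.
    refine PhragmenLindelof.horizontal_strip (a := 0) (b := φ)
      (f := fun w => H (Complex.exp w) *
        Complex.exp (Complex.I * (σ : ℝ) * (Complex.exp w) ^ 2)) ?_ ?_ ?_ ?_ ?_ ?_
    · apply Differentiable.diffContOnCl
      have := hH.comp Complex.differentiable_exp
      exact this.mul (by fun_prop)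
    · refine ⟨2, ?_, a, ?_⟩
      · rw [sub_zero, lt_div_iff₀ hφ0]; linarith
      · refine Asymptotics.IsBigO.of_bound C ?_
        refine Filter.Eventually.filter_mono inf_le_right ?_
        refine Filter.eventually_principal.2 fun w hw => ?_
        have hw' : 0 < w.im ∧ w.im < φ := hw
        have hc : 0 < Real.cos w.im := Real.cos_pos_of_mem_Ioo ⟨by linarith, by linarith⟩
        have hs : 0 < Real.sin w.im :=
          Real.sin_pos_of_pos_of_lt_pi hw'.1 (by linarith [Real.pi_pos])
        have hre : (Complex.exp w).re = Real.exp w.re * Real.cos w.im := Complex.exp_re w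
        have him : (Complex.exp w).im = Real.exp w.re * Real.sin w.im := Complex.exp_im w
        rw [hnorm, Real.norm_of_nonneg (Real.exp_pos _).le]
        have h3 : Real.exp (-2 * σ * (Complex.exp w).re * (Complex.exp w).im) ≤ 1 := by
          rw [Real.exp_le_one_iff, hre, him]
          have : 0 ≤ 2 * σ * (Real.exp w.re * Real.cos w.im) *
            (Real.exp w.re * Real.sin w.im) := by positivity
          linarith
        have h4 : (Complex.exp w).re ^ 2 ≤ Real.exp (2 * |w.re|) := by
          rw [hre, mul_pow, ← Real.exp_nat_mul]
          have h5 : Real.cos w.im ^ 2 ≤ 1 := Real.cos_sq_le_one _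
          have h6 : Real.exp ((2 : ℕ) * w.re) ≤ Real.exp (2 * |w.re|) := by
            apply Real.exp_le_exp.2
            push_cast
            linarith [le_abs_self w.re]
          calc _ ≤ Real.exp ((2 : ℕ) * w.re) * 1 := by gcongr
            _ ≤ _ := by simpa using h6
        calc _ ≤ (C * Real.exp (a * (Complex.exp w).re ^ 2)) * 1 := by
              gcongr
              exact hgrow _
          _ ≤ _ := by
              rw [mul_one]
              gcongr
    · intro w hw
      have him : (Complex.exp w).im = 0 := by rw [Complex.exp_im, hw]; simp
      rw [hnorm, him]
      have : Complex.exp w = ((Complex.exp w).re : ℂ) := by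
        apply Complex.ext <;> simp [him]
      rw [this]
      simpa using hreal _
    · intro w hw
      have hre : (Complex.exp w).re = Real.exp w.re * Real.cos φ := by rw [Complex.exp_re, hw]
      have him : (Complex.exp w).im = Real.exp w.re * Real.sin φ := by rw [Complex.exp_im, hw]
      rw [hnorm]
      calc _ ≤ (C * Real.exp (a * (Complex.exp w).re ^ 2)) *
            Real.exp (-2 * σ * (Complex.exp w).re * (Complex.exp w).im) := by
              gcongr
              exact hgrow _
        _ = C := by
            rw [mul_assoc, ← Real.exp_add, hre, him, hσ]
            have : a * (Real.exp w.re * Real.cos φ) ^ 2 +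
                -2 * (a / 2 * (Real.cos φ / Real.sin φ)) * (Real.exp w.re * Real.cos φ) *
                  (Real.exp w.re * Real.sin φ) = 0 := by
              field_simp
              ring
            rw [this]; simp
    · rw [him_log]; exact hθ0
    · rw [him_log]; exact h1.le
  have hlim : Filter.Tendsto (fun φ : ℝ =>
      ‖H z * Complex.exp (Complex.I * (a / 2 * (Real.cos φ / Real.sin φ) : ℝ) * z ^ 2)‖)
      (nhdsWithin (Real.pi / 2) (Set.Iio (Real.pi / 2))) (nhds ‖H z‖) := by
    have hcont : ContinuousAt (fun φ : ℝ =>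
        ‖H z * Complex.exp (Complex.I * (a / 2 * (Real.cos φ / Real.sin φ) : ℝ) * z ^ 2)‖)
        (Real.pi / 2) := by
      have h1 : ContinuousAt (fun φ : ℝ => a / 2 * (Real.cos φ / Real.sin φ)) (Real.pi / 2) :=
        continuousAt_const.mul (Real.continuous_cos.continuousAt.div
          Real.continuous_sin.continuousAt (by simp))
      have h2 := Complex.continuous_ofReal.continuousAt.comp h1
      have h3 : ContinuousAt (fun φ : ℝ =>
          Complex.I * (a / 2 * (Real.cos φ / Real.sin φ) : ℝ) * z ^ 2) (Real.pi / 2) :=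
        (continuousAt_const.mul h2).mul continuousAt_const
      exact (continuousAt_const.mul (Complex.continuous_exp.continuousAt.comp h3)).norm
    have := hcont.tendsto.mono_left (nhdsWithin_le_nhds (s := Set.Iio (Real.pi / 2)))
    simpa using this
  refine le_of_tendsto hlim ?_
  filter_upwards [Ioo_mem_nhdsLT hθ1] with φ hφ
  exact key φ hφ.1 hφ.2

/-- An entire function of Gaussian growth in the imaginary direction and Gaussian decay of the
same rate on the real axis is a Gaussian. -/
theorem eq_gaussian_of_growth_of_decay {F : ℂ → ℂ} (hF : Differentiable ℂ F) {a C : ℝ} (ha : 0 < a)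
    (hgrow : ∀ z : ℂ, ‖F z‖ ≤ C * Real.exp (a * z.im ^ 2))
    (hdecay : ∀ x : ℝ, ‖F x‖ ≤ C * Real.exp (-a * x ^ 2)) (z : ℂ) :
    F z = F 0 * Complex.exp (-a * z ^ 2) := by
  -- The factor `e^{az²}` turns growth in `Im z` into growth in `Re z`. Thus `H` is bounded by `C`
  -- on both axes, and the quadrant estimate applies.
  set H : ℂ → ℂ := fun z => F z * Complex.exp (a * z ^ 2) with hHdef
  have hH : Differentiable ℂ H := hF.mul (by fun_prop)
  have hexp : ∀ z : ℂ, ‖Complex.exp (a * z ^ 2)‖ = Real.exp (a * (z.re ^ 2 - z.im ^ 2)) := by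
    intro z
    rw [Complex.norm_exp]
    congr 1
    simp [pow_two]
  have hHgrow : ∀ z : ℂ, ‖H z‖ ≤ C * Real.exp (a * z.re ^ 2) := by
    intro z
    rw [hHdef, norm_mul, hexp]
    calc _ ≤ C * Real.exp (a * z.im ^ 2) * Real.exp (a * (z.re ^ 2 - z.im ^ 2)) := by
          gcongr; exact hgrow z
      _ = _ := by rw [mul_assoc, ← Real.exp_add]; ring_nf
  have hHreal : ∀ x : ℝ, ‖H x‖ ≤ C := by
    intro x
    rw [hHdef, norm_mul, hexp]
    calc _ ≤ C * Real.exp (-a * x ^ 2) *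
            Real.exp (a * ((x : ℂ).re ^ 2 - (x : ℂ).im ^ 2)) := by
          gcongr; exact hdecay x
      _ = _ := by rw [mul_assoc, ← Real.exp_add]; simp
  -- Conjugation carries the lower right quadrant to the upper right one; `z ↦ -z` will handle the
  -- left half-plane.
  have hmirror : ∀ G : ℂ → ℂ, Differentiable ℂ G →
      (∀ z : ℂ, ‖G z‖ ≤ C * Real.exp (a * z.re ^ 2)) → (∀ x : ℝ, ‖G x‖ ≤ C) →
      ∀ z : ℂ, 0 < z.re → z.im ≠ 0 → ‖G z‖ ≤ C := by
    intro G hG h1 h2 z hre him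
    rcases lt_or_gt_of_ne him with h | h
    · have h3 := norm_le_of_quadrant (H := star ∘ G ∘ star) (z := star z)
        (fun w => by simpa using (hG (star w)).star_star) ha (fun z => by simpa using h1 (star z))
        (fun x => by simpa using h2 x) (by simpa using hre) (by simpa using h)
      simpa using h3
    · exact norm_le_of_quadrant hG ha h1 h2 hre h
  have hbound : ∀ z : ℂ, ‖H z‖ ≤ C := by
    intro z
    by_cases hre : z.re = 0
    · simpa [hre] using hHgrow z
    by_cases him : z.im = 0
    · have : z = (z.re : ℂ) := by apply Complex.ext <;> simp [him]
      rw [this]; exact hHreal _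
    rcases lt_or_gt_of_ne hre with h | h
    · have := hmirror (fun z => H (-z)) (hH.comp differentiable_neg)
        (fun z => by simpa using hHgrow (-z)) (fun x => by simpa using hHreal (-x)) (-z)
        (by simpa using h) (by simpa using him)
      simpa using this
    · exact hmirror H hH hHgrow hHreal z h him
  have hconst : H z = H 0 :=
    hH.apply_eq_apply_of_bounded ((Metric.isBounded_closedBall (x := (0 : ℂ)) (r := C)).subset
      (by rintro _ ⟨w, rfl⟩; simpa using hbound w)) z 0
  have h0 : H 0 = F 0 := by simp [hHdef]
  rw [← h0, ← hconst, hHdef]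
  simp only
  rw [mul_assoc, ← Complex.exp_add]
  simp

/-! ### The Fourier transform on `L¹` and on `L¹ ∩ L²`. -/

section FourierL1

variable {V : Type*} [NormedAddCommGroup V] [InnerProductSpace ℝ V] [FiniteDimensional ℝ V]
  [MeasurableSpace V] [BorelSpace V]

theorem integral_fourier_mul_schwartz {g : V → ℂ} (hg : Integrable g) (s : SchwartzMap V ℂ) :
    ∫ x, 𝓕 g x * s x = ∫ x, g x * 𝓕 s x := by
  have := VectorFourier.integral_fourierIntegral_smul_eq_flip (μ := (volume : Measure V))
    (ν := (volume : Measure V)) (L := innerₗ V) (f := g) (g := s) Real.continuous_fourierChar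
    (by exact continuous_inner) hg s.integrable
  rw [flip_innerₗ] at this
  exact this

theorem ae_eq_zero_of_integral_mul_schwartz_eq_zero {g : V → ℂ} (hg : LocallyIntegrable g)
    (h : ∀ s : SchwartzMap V ℂ, ∫ x, g x * s x = 0) : g =ᵐ[volume] 0 := by
  refine ae_eq_zero_of_integral_contDiff_smul_eq_zero hg fun φ hφ hcomp => ?_
  have hg₁ : HasCompactSupport (Complex.ofRealCLM ∘ φ) := hcomp.comp_left rfl
  have hg₂ : ContDiff ℝ (⊤ : ℕ∞) (Complex.ofRealCLM ∘ φ) := by fun_prop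
  rw [← h (hg₁.toSchwartzMap hg₂)]
  refine integral_congr_ae (Filter.Eventually.of_forall fun x => ?_)
  simp [mul_comm]

/-- The Fourier transform is injective on `L¹`. -/
theorem ae_eq_zero_of_fourier_eq_zero {g : V → ℂ} (hg : Integrable g) (h : 𝓕 g = 0) :
    g =ᵐ[volume] 0 := by
  refine ae_eq_zero_of_integral_mul_schwartz_eq_zero hg.locallyIntegrable fun s => ?_
  -- Every Schwartz function is a Fourier transform, so vanishing of `𝓕 g` makes every Schwartz
  -- pairing with `g` vanish.
  have := integral_fourier_mul_schwartz hg (𝓕⁻ s)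
  rw [h] at this
  simpa using this.symm

theorem ae_eq_of_fourier_eq {g h : V → ℂ} (hg : Integrable g) (hh : Integrable h)
    (H : 𝓕 g = 𝓕 h) : g =ᵐ[volume] h := by
  have h0 : 𝓕 (g - h) = 0 := by
    ext w
    have := congrFun H w
    simp only [Real.fourier_eq] at this ⊢
    simp only [Pi.sub_apply, smul_sub]
    rw [integral_sub ((Real.fourierIntegral_convergent_iff w).2 hg)
      ((Real.fourierIntegral_convergent_iff w).2 hh), this]
    simp
  filter_upwards [ae_eq_zero_of_fourier_eq_zero (hg.sub hh) h0] with x hx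
  exact sub_eq_zero.1 hx

theorem continuous_fourier {g : V → ℂ} (hg : Integrable g) : Continuous (𝓕 g) :=
  VectorFourier.fourierIntegral_continuous Real.continuous_fourierChar
    (by exact continuous_inner) hg

/-- On `L¹ ∩ L²` the `L²` Fourier transform is given by the Fourier integral. -/
theorem coeFn_fourier_toLp {g : V → ℂ} (hg : Integrable g) (hg2 : MemLp g 2 volume) :
    (𝓕 (hg2.toLp g) : Lp (α := V) ℂ 2 volume) =ᵐ[volume] 𝓕 g := by
  have hloc : LocallyIntegrable (fun x => (𝓕 (hg2.toLp g) : Lp (α := V) ℂ 2 volume) x - 𝓕 g x) :=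
    ((Lp.memLp _).locallyIntegrable (by norm_num)).sub (continuous_fourier hg).locallyIntegrable
  have h := ae_eq_zero_of_integral_mul_schwartz_eq_zero hloc fun s => ?_
  · filter_upwards [h] with x hx
    exact sub_eq_zero.1 hx
  -- The two transforms are compared as tempered distributions, where each is defined by moving `𝓕`
  -- onto the test function.
  have h1 := congrArg (fun T => T s) (Lp.fourier_toTemperedDistribution_eq (hg2.toLp g))
  simp only [TemperedDistribution.fourier_apply, Lp.toTemperedDistribution_apply] at h1
  have h2 : ∫ x, (𝓕 s) x • (hg2.toLp g x) = ∫ x, 𝓕 g x * s x := by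
    rw [integral_fourier_mul_schwartz hg]
    refine integral_congr_ae ?_
    filter_upwards [hg2.coeFn_toLp] with x hx
    rw [hx, smul_eq_mul, mul_comm]
  rw [h2] at h1
  simp only [sub_mul]
  rw [integral_sub, h1, sub_eq_zero]
  · simp only [smul_eq_mul, mul_comm]
  · exact MemLp.integrable_mul (p := 2) (q := 2) (Lp.memLp _) (s.memLp 2)
  · refine (s.integrable.norm.const_mul (∫ x, ‖g x‖)).mono'
      ((continuous_fourier hg).mul s.continuous).aestronglyMeasurable ?_
    refine Filter.Eventually.of_forall fun x => ?_
    rw [norm_mul]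
    gcongr
    exact VectorFourier.norm_fourierIntegral_le_integral_norm _ _ _ _ _

end FourierL1

/-! ### Quadratic forms and Gaussian integrals. -/

section Gaussian

variable {E : Type*} [NormedAddCommGroup E] [InnerProductSpace ℝ E] [FiniteDimensional ℝ E]

theorem LinearMap.IsSymmetric.exists_orthonormalBasis {T : E →ₗ[ℝ] E} (hT : T.IsSymmetric) :
    ∃ (b : OrthonormalBasis (Fin (Module.finrank ℝ E)) ℝ E)
      (p : Fin (Module.finrank ℝ E) → ℝ), ∀ i, T (b i) = p i • b i :=
  ⟨hT.eigenvectorBasis rfl, hT.eigenvalues rfl, fun i => hT.apply_eigenvectorBasis rfl i⟩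

omit [FiniteDimensional ℝ E] in
theorem inner_eq_sum_of_eigenbasis {ι : Type*} [Fintype ι] {T : E →ₗ[ℝ] E} (hT : T.IsSymmetric)
    {b : OrthonormalBasis ι ℝ E} {p : ι → ℝ} (h : ∀ i, T (b i) = p i • b i) (x y : E) :
    inner ℝ (T x) y = ∑ i, p i * (inner ℝ (b i) x * inner ℝ (b i) y) := by
  rw [← b.sum_inner_mul_inner]
  refine Finset.sum_congr rfl fun i _ => ?_
  rw [hT, h, real_inner_smul_right, real_inner_comm x]
  ring

/-- The smallest eigenvalue serves as `m`; any positive number will do in dimension zero. -/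
theorem exists_coercive {T : E →ₗ[ℝ] E} (hT : T.IsSymmetric)
    (hpos : ∀ x, x ≠ 0 → 0 < inner ℝ (T x) x) :
    ∃ m : ℝ, 0 < m ∧ ∀ x, m * ‖x‖ ^ 2 ≤ inner ℝ (T x) x := by
  obtain ⟨b, p, h⟩ := hT.exists_orthonormalBasis
  have hp : ∀ i, 0 < p i := fun i => by
    have := hpos (b i) (b.orthonormal.ne_zero i)
    rw [h, real_inner_smul_left, real_inner_self_eq_norm_sq, b.norm_eq_one] at this
    simpa using this
  obtain ⟨m, hm, hmp⟩ : ∃ m : ℝ, 0 < m ∧ ∀ i, m ≤ p i := by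
    by_cases hne : Nonempty (Fin (Module.finrank ℝ E))
    · obtain ⟨i, hi⟩ := Finite.exists_min p
      exact ⟨p i, hp i, hi⟩
    · exact ⟨1, one_pos, fun i => (hne ⟨i⟩).elim⟩
  refine ⟨m, hm, fun x => ?_⟩
  rw [inner_eq_sum_of_eigenbasis hT h, ← real_inner_self_eq_norm_sq, ← b.sum_inner_mul_inner,
    Finset.mul_sum]
  refine Finset.sum_le_sum fun i _ => ?_
  rw [real_inner_comm x]
  exact mul_le_mul_of_nonneg_right (hmp i) (mul_self_nonneg _)

variable [MeasurableSpace E] [BorelSpace E]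

theorem integrable_exp_neg_mul_sq_norm {δ : ℝ} (hδ : 0 < δ) :
    Integrable (fun x : E => Real.exp (-δ * ‖x‖ ^ 2)) := by
  have := GaussianFourier.integrable_cexp_neg_mul_sq_norm_add (V := E) (b := δ)
    (by simpa using hδ) 0 0
  refine this.norm.congr (Filter.Eventually.of_forall fun x => ?_)
  simp only [zero_mul, add_zero]
  rw [Complex.norm_exp]
  congr 1
  rw [← Complex.ofReal_pow, ← Complex.ofReal_neg, ← Complex.ofReal_mul, Complex.ofReal_re]

/-- Completing the square, half of the quadratic decay absorbs the linear term at the cost of the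
constant `e^{c²/(2δ)}`. -/
theorem integrable_exp_neg_mul_sq_norm_add {δ : ℝ} (hδ : 0 < δ) (c : ℝ) :
    Integrable (fun x : E => Real.exp (-δ * ‖x‖ ^ 2 + c * ‖x‖)) := by
  refine ((integrable_exp_neg_mul_sq_norm (E := E) (half_pos hδ)).const_mul
    (Real.exp (c ^ 2 / (2 * δ)))).mono' (by fun_prop) (Filter.Eventually.of_forall fun x => ?_)
  rw [Real.norm_of_nonneg (Real.exp_pos _).le, ← Real.exp_add]
  apply Real.exp_le_exp.2
  have : c ^ 2 / (2 * δ) + -(δ / 2) * ‖x‖ ^ 2 - (-δ * ‖x‖ ^ 2 + c * ‖x‖) =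
      (c - δ * ‖x‖) ^ 2 / (2 * δ) := by field_simp; ring
  have h2 : 0 ≤ (c - δ * ‖x‖) ^ 2 / (2 * δ) := by positivity
  linarith

theorem integrable_of_gaussian_bound {g : E → ℂ} (hg : AEStronglyMeasurable g volume) {C δ : ℝ}
    (hδ : 0 < δ) (hb : ∀ᵐ x, ‖g x‖ ≤ C * Real.exp (-δ * ‖x‖ ^ 2)) : Integrable g :=
  ((integrable_exp_neg_mul_sq_norm hδ).const_mul C).mono' hg hb

theorem memLp_two_of_gaussian_bound {g : E → ℂ} (hg : AEStronglyMeasurable g volume) {C δ : ℝ}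
    (hδ : 0 < δ) (hb : ∀ᵐ x, ‖g x‖ ≤ C * Real.exp (-δ * ‖x‖ ^ 2)) : MemLp g 2 := by
  rw [memLp_two_iff_integrable_sq_norm hg]
  refine ((integrable_exp_neg_mul_sq_norm (E := E) (δ := 2 * δ) (by positivity)).const_mul
    (C ^ 2)).mono' (hg.norm.pow 2) ?_
  filter_upwards [hb] with x hx
  rw [Real.norm_of_nonneg (by positivity)]
  calc ‖g x‖ ^ 2 ≤ (C * Real.exp (-δ * ‖x‖ ^ 2)) ^ 2 := by gcongr
    _ = _ := by rw [mul_pow, ← Real.exp_nat_mul]; congr 2; push_cast; ring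

/-- The Gaussian integral in the coordinates of an orthonormal basis. -/
theorem integral_cexp_neg_sum_inner {ι : Type*} [Fintype ι] (b : OrthonormalBasis ι ℝ E)
    {c : ι → ℂ} (hc : ∀ i, 0 < (c i).re) (u : ι → ℂ) :
    ∫ x : E, Complex.exp (-∑ i, c i * ((inner ℝ (b i) x : ℝ) : ℂ) ^ 2 +
        ∑ i, u i * ((inner ℝ (b i) x : ℝ) : ℂ)) =
      ∏ i, (Real.pi / c i) ^ (1 / 2 : ℂ) * Complex.exp (u i ^ 2 / (4 * c i)) := by
  rw [← GaussianFourier.integral_cexp_neg_sum_mul_add hc u,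
    ← (PiLp.volume_preserving_toLp ι).symm.integral_comp
      (MeasurableEquiv.toLp 2 _).symm.measurableEmbedding,
    ← b.measurePreserving_repr.integral_comp b.repr.toHomeomorph.measurableEmbedding]
  refine integral_congr_ae (Filter.Eventually.of_forall fun x => ?_)
  simp [b.repr_apply_apply]

end Gaussian

/-! ### Hardy's uncertainty principle for quadratic forms. -/

section Hardy

variable {E : Type*} [NormedAddCommGroup E] [InnerProductSpace ℝ E] [FiniteDimensional ℝ E]
  [MeasurableSpace E] [BorelSpace E]

omit [MeasurableSpace E] [BorelSpace E] in
theorem continuous_inner_map_self (T : E →ₗ[ℝ] E) : Continuous fun x => inner ℝ (T x) x :=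
  T.continuous_of_finiteDimensional.inner continuous_id

/-- The Fourier integral of a function of Gaussian decay along a complex line. -/
noncomputable def complexLineFourier (g : E → ℂ) (ξ v : E) (z : ℂ) : ℂ :=
  ∫ x, g x * Complex.exp (-2 * Real.pi * Complex.I *
    ((inner ℝ x ξ : ℝ) + z * (inner ℝ x v : ℝ)))

theorem complexLineFourier_ofReal (g : E → ℂ) (ξ v : E) (t : ℝ) :
    complexLineFourier g ξ v t = 𝓕 g (ξ + t • v) := by
  rw [complexLineFourier, Real.fourier_eq']
  refine integral_congr_ae (Filter.Eventually.of_forall fun x => ?_)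
  simp only [smul_eq_mul]
  rw [mul_comm, inner_add_right, real_inner_smul_right]
  congr 2
  push_cast
  ring

omit [FiniteDimensional ℝ E] [MeasurableSpace E] [BorelSpace E] in
theorem norm_cexp_line (x ξ v : E) (z : ℂ) :
    ‖Complex.exp (-2 * Real.pi * Complex.I * ((inner ℝ x ξ : ℝ) + z * (inner ℝ x v : ℝ)))‖ =
      Real.exp (2 * Real.pi * z.im * inner ℝ x v) := by
  rw [Complex.norm_exp]
  congr 1
  simp [mul_assoc]

omit [FiniteDimensional ℝ E] [MeasurableSpace E] [BorelSpace E] in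
theorem exp_neg_inner_le_of_coercive {M : E →ₗ[ℝ] E} {m : ℝ}
    (hMm : ∀ x, m * ‖x‖ ^ 2 ≤ inner ℝ (M x) x) (x : E) :
    Real.exp (-Real.pi * inner ℝ (M x) x) ≤ Real.exp (-(Real.pi * m) * ‖x‖ ^ 2) := by
  apply Real.exp_le_exp.2
  nlinarith [hMm x, Real.pi_pos]

theorem differentiable_complexLineFourier {g : E → ℂ} (hg : AEStronglyMeasurable g volume)
    {C δ : ℝ} (hδ : 0 < δ) (hb : ∀ᵐ x, ‖g x‖ ≤ C * Real.exp (-δ * ‖x‖ ^ 2)) (ξ v : E) :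
    Differentiable ℂ (complexLineFourier g ξ v) := by
  intro z
  set c : ℝ := 2 * Real.pi * (|z.im| + 1) * ‖v‖ + 2 * Real.pi * ‖v‖ with hc
  have hmeas : ∀ w : ℂ, AEStronglyMeasurable (fun x : E => g x *
      Complex.exp (-2 * Real.pi * Complex.I *
        ((inner ℝ x ξ : ℝ) + w * (inner ℝ x v : ℝ)))) volume := fun w =>
    hg.mul (by fun_prop)
  have hker : ∀ w ∈ Metric.ball z 1, ∀ x : E,
      ‖Complex.exp (-2 * Real.pi * Complex.I * ((inner ℝ x ξ : ℝ) + w * (inner ℝ x v : ℝ)))‖ ≤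
        Real.exp (2 * Real.pi * (|z.im| + 1) * ‖v‖ * ‖x‖) := by
    intro w hw x
    rw [norm_cexp_line]
    apply Real.exp_le_exp.2
    have h1 : |w.im| ≤ |z.im| + 1 := by
      have h2 : |(w - z).im| ≤ 1 :=
        (Complex.abs_im_le_norm _).trans (by simpa [dist_eq_norm] using (Metric.mem_ball.1 hw).le)
      have h3 : w.im = z.im + (w - z).im := by simp
      rw [h3]
      exact (abs_add_le _ _).trans (by linarith)
    have h2 : |inner ℝ x v| ≤ ‖x‖ * ‖v‖ := abs_real_inner_le_norm x v
    calc 2 * Real.pi * w.im * inner ℝ x v ≤ |2 * Real.pi * w.im * inner ℝ x v| := le_abs_self _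
      _ = 2 * Real.pi * |w.im| * |inner ℝ x v| := by
          rw [abs_mul, abs_mul, abs_of_pos Real.two_pi_pos]
      _ ≤ 2 * Real.pi * (|z.im| + 1) * (‖x‖ * ‖v‖) := by
          have := Real.pi_pos
          gcongr
      _ = _ := by ring
  have hmain := hasDerivAt_integral_of_dominated_loc_of_deriv_le (μ := (volume : Measure E))
    (s := Metric.ball z 1) (x₀ := z)
    (F := fun w x => g x * Complex.exp (-2 * Real.pi * Complex.I *
      ((inner ℝ x ξ : ℝ) + w * (inner ℝ x v : ℝ))))
    (F' := fun w x => g x * (Complex.exp (-2 * Real.pi * Complex.I *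
      ((inner ℝ x ξ : ℝ) + w * (inner ℝ x v : ℝ))) *
      (-2 * Real.pi * Complex.I * (inner ℝ x v : ℝ))))
    (bound := fun x => C * Real.exp (-δ * ‖x‖ ^ 2 + c * ‖x‖))
    (Metric.ball_mem_nhds z one_pos) (Filter.Eventually.of_forall hmeas) ?_ ?_ ?_ ?_ ?_
  · exact hmain.2.differentiableAt
  · refine ((integrable_exp_neg_mul_sq_norm_add hδ (2 * Real.pi * (|z.im| + 1) * ‖v‖)).const_mul
      C).mono' (hmeas z) ?_
    filter_upwards [hb] with x hx
    rw [norm_mul]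
    simp only [Real.exp_add]
    rw [← mul_assoc]
    exact mul_le_mul hx (hker z (Metric.mem_ball_self one_pos) x) (norm_nonneg _)
      ((norm_nonneg _).trans hx)
  · exact hg.mul (by fun_prop)
  · filter_upwards [hb] with x hx w hw
    rw [norm_mul, norm_mul, Real.exp_add, ← mul_assoc C]
    refine mul_le_mul hx ?_ (by positivity) ((norm_nonneg _).trans hx)
    rw [hc, add_mul, Real.exp_add]
    refine mul_le_mul (hker w hw x) ?_ (norm_nonneg _) (Real.exp_pos _).le
    have h2 : |inner ℝ x v| ≤ ‖x‖ * ‖v‖ := abs_real_inner_le_norm x v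
    have h3 : ‖(-2 * Real.pi * Complex.I * (inner ℝ x v : ℝ) : ℂ)‖ =
        2 * Real.pi * |inner ℝ x v| := by
      simp [abs_of_pos Real.pi_pos]
    rw [h3]
    have h4 : 2 * Real.pi * |inner ℝ x v| ≤ 2 * Real.pi * ‖v‖ * ‖x‖ := by
      have := Real.pi_pos
      calc _ ≤ 2 * Real.pi * (‖x‖ * ‖v‖) := by gcongr
        _ = _ := by ring
    linarith [Real.add_one_le_exp (2 * Real.pi * ‖v‖ * ‖x‖)]
  · exact (integrable_exp_neg_mul_sq_norm_add hδ c).const_mul C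
  · refine Filter.Eventually.of_forall fun x w _ => ?_
    refine HasDerivAt.const_mul _ (HasDerivAt.cexp ?_)
    have h1 : HasDerivAt (fun w : ℂ => (inner ℝ x ξ : ℝ) + w * (inner ℝ x v : ℝ))
        ((inner ℝ x v : ℝ) : ℂ) w := by
      simpa using ((hasDerivAt_id w).mul_const ((inner ℝ x v : ℝ) : ℂ)).const_add
        ((inner ℝ x ξ : ℝ) : ℂ)
    exact h1.const_mul _

/-- The direction `Mu` is the one in which the square completes: with `y = Im z`, `-Mx·x + 2y x·Mu =
y² Mu·u - M(x - yu)·(x - yu)`. Translation invariance then leaves the same integral for every `z`.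
-/
theorem norm_complexLineFourier_le {M : E →ₗ[ℝ] E} (hM : M.IsSymmetric) {g : E → ℂ}
    {C m : ℝ} (hm : 0 < m) (hMm : ∀ x, m * ‖x‖ ^ 2 ≤ inner ℝ (M x) x)
    (hb : ∀ᵐ x, ‖g x‖ ≤ C * Real.exp (-Real.pi * inner ℝ (M x) x)) (ξ u : E) (z : ℂ) :
    ‖complexLineFourier g ξ (M u) z‖ ≤ (C * ∫ x, Real.exp (-Real.pi * inner ℝ (M x) x)) *
      Real.exp (Real.pi * inner ℝ (M u) u * z.im ^ 2) := by
  have hint : Integrable (fun x : E => Real.exp (-Real.pi * inner ℝ (M x) x)) := by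
    refine (integrable_exp_neg_mul_sq_norm (E := E) (δ := Real.pi * m)
      (mul_pos Real.pi_pos hm)).mono' ?_ (Filter.Eventually.of_forall fun x => ?_)
    · have := continuous_inner_map_self M
      exact (by fun_prop : Continuous _).aestronglyMeasurable
    · rw [Real.norm_of_nonneg (Real.exp_pos _).le]
      exact exp_neg_inner_le_of_coercive hMm x
  have hcomp : ∀ x : E, Real.exp (-Real.pi * inner ℝ (M x) x) *
      Real.exp (2 * Real.pi * z.im * inner ℝ x (M u)) =
      Real.exp (Real.pi * inner ℝ (M u) u * z.im ^ 2) *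
        Real.exp (-Real.pi * inner ℝ (M (x - z.im • u)) (x - z.im • u)) := by
    intro x
    rw [← Real.exp_add, ← Real.exp_add]
    congr 1
    simp only [map_sub, map_smul, inner_sub_left, inner_sub_right, real_inner_smul_left,
      real_inner_smul_right]
    rw [hM x u, real_inner_comm x (M u)]
    ring
  rw [complexLineFourier]
  calc _ ≤ ∫ x, C * (Real.exp (Real.pi * inner ℝ (M u) u * z.im ^ 2) *
        Real.exp (-Real.pi * inner ℝ (M (x - z.im • u)) (x - z.im • u))) := by
        refine norm_integral_le_of_norm_le (((hint.comp_sub_right (z.im • u)).const_mul _).const_mul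
          C) ?_
        filter_upwards [hb] with x hx
        rw [norm_mul, norm_cexp_line, ← hcomp, ← mul_assoc]
        gcongr
    _ = _ := by
        rw [integral_const_mul, integral_const_mul, integral_sub_right_eq_self
          (fun x => Real.exp (-Real.pi * inner ℝ (M x) x))]
        ring

/-- The restriction of the Fourier transform to a line on which it decays at the critical rate. -/
theorem fourier_line_eq_gaussian {M : E →ₗ[ℝ] E} (hM : M.IsSymmetric) {g : E → ℂ}
    (hg : AEStronglyMeasurable g volume) {C m : ℝ} (hm : 0 < m)
    (hMm : ∀ x, m * ‖x‖ ^ 2 ≤ inner ℝ (M x) x)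
    (hb : ∀ᵐ x, ‖g x‖ ≤ C * Real.exp (-Real.pi * inner ℝ (M x) x)) (ξ : E) {u : E} (hu : u ≠ 0)
    {C' : ℝ} (hdec : ∀ t : ℝ, ‖𝓕 g (ξ + t • M u)‖ ≤
      C' * Real.exp (-(Real.pi * inner ℝ (M u) u) * t ^ 2)) (t : ℝ) :
    𝓕 g (ξ + t • M u) =
      𝓕 g ξ * Complex.exp (-((Real.pi * inner ℝ (M u) u : ℝ) : ℂ) * (t : ℂ) ^ 2) := by
  have ha : 0 < Real.pi * inner ℝ (M u) u :=
    mul_pos Real.pi_pos ((mul_pos hm (pow_pos (norm_pos_iff.2 hu) 2)).trans_le (hMm u))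
  have hC : 0 ≤ C := by
    obtain ⟨x, hx⟩ := hb.exists
    exact nonneg_of_mul_nonneg_left ((norm_nonneg _).trans hx) (Real.exp_pos _)
  have hb' : ∀ᵐ x, ‖g x‖ ≤ C * Real.exp (-(Real.pi * m) * ‖x‖ ^ 2) := by
    filter_upwards [hb] with x hx
    exact hx.trans (mul_le_mul_of_nonneg_left (exp_neg_inner_le_of_coercive hMm x) hC)
  set K := max (C * ∫ x, Real.exp (-Real.pi * inner ℝ (M x) x)) C'
  have h := eq_gaussian_of_growth_of_decay (C := K)
    (differentiable_complexLineFourier hg (mul_pos Real.pi_pos hm) hb' ξ (M u)) ha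
    (fun z => (norm_complexLineFourier_le hM hm hMm hb ξ u z).trans (by
      gcongr; exact le_max_left _ _))
    (fun x => by
      rw [complexLineFourier_ofReal]
      exact (hdec x).trans (by gcongr; exact le_max_right _ _)) t
  have h0 := complexLineFourier_ofReal g ξ (M u) 0
  rw [Complex.ofReal_zero, zero_smul, add_zero] at h0
  rw [complexLineFourier_ofReal, h0] at h
  exact h

/-- Hardy's uncertainty principle, supercritical case in one eigendirection. -/
theorem ae_eq_zero_of_hardy {M B : E →ₗ[ℝ] E} (hM : M.IsSymmetric) (hB : B.IsSymmetric) {g : E → ℂ}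
    (hg : AEStronglyMeasurable g volume) {C m : ℝ} (hm : 0 < m)
    (hMm : ∀ x, m * ‖x‖ ^ 2 ≤ inner ℝ (M x) x)
    (hb : ∀ᵐ x, ‖g x‖ ≤ C * Real.exp (-Real.pi * inner ℝ (M x) x))
    {C' : ℝ} (hdec : ∀ ζ, ‖𝓕 g ζ‖ ≤ C' * Real.exp (-Real.pi * inner ℝ (B ζ) ζ))
    {u : E} (hu : u ≠ 0) {l : ℝ} (hl : 1 < l) (hBM : B (M u) = l • u) : 𝓕 g = 0 := by
  ext ξ
  set a := inner ℝ (M u) u with hadef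
  have ha : 0 < a := (mul_pos hm (pow_pos (norm_pos_iff.2 hu) 2)).trans_le (hMm u)
  have hC' : 0 ≤ C' :=
    nonneg_of_mul_nonneg_left ((norm_nonneg _).trans (hdec 0)) (Real.exp_pos _)
  set β := inner ℝ u ξ
  set κ := inner ℝ (B ξ) ξ
  have hline : ∀ t : ℝ, inner ℝ (B (ξ + t • M u)) (ξ + t • M u) =
      κ + 2 * t * l * β + t ^ 2 * l * a := by
    intro t
    have h1 : inner ℝ (B ξ) (M u) = l * β := by
      rw [hB, hBM, real_inner_smul_right, real_inner_comm]
    simp only [map_add, map_smul, inner_add_left, inner_add_right, real_inner_smul_left,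
      real_inner_smul_right, h1, hBM]
    rw [real_inner_comm (M u) u]
    ring
  have hdec' : ∀ t : ℝ, ‖𝓕 g (ξ + t • M u)‖ ≤
      C' * Real.exp (-Real.pi * (κ + 2 * t * l * β + t ^ 2 * l * a)) := fun t => by
    rw [← hline]; exact hdec _
  have hla : 0 < (l - 1) * a := mul_pos (by linarith) ha
  have hl0 : l - 1 ≠ 0 := (sub_pos.2 hl).ne'
  -- The line need not pass through the origin, which creates the linear term `2tlβ`. The surplus
  -- `(l - 1)a t²` bounds it from below, leaving decay at the critical rate `πa`.
  have hsq : ∀ t : ℝ, -(l * β) ^ 2 / ((l - 1) * a) ≤ 2 * t * l * β + t ^ 2 * ((l - 1) * a) := by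
    intro t
    have : 2 * t * l * β + t ^ 2 * ((l - 1) * a) - -(l * β) ^ 2 / ((l - 1) * a) =
        (t * ((l - 1) * a) + l * β) ^ 2 / ((l - 1) * a) := by
      field_simp
      ring
    have h2 : 0 ≤ (t * ((l - 1) * a) + l * β) ^ 2 / ((l - 1) * a) := by positivity
    linarith
  have hgauss := fourier_line_eq_gaussian hM hg hm hMm hb ξ hu
    (C' := C' * Real.exp (-Real.pi * (κ + -(l * β) ^ 2 / ((l - 1) * a)))) (fun t => by
      refine (hdec' t).trans ?_
      rw [mul_assoc C', ← Real.exp_add]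
      refine mul_le_mul_of_nonneg_left (Real.exp_le_exp.2 ?_) hC'
      rw [← hadef]
      nlinarith [hsq t, Real.pi_pos])
  -- The exact Gaussian has rate `πa` while the bound has rate `πla`. Dividing leaves a quantity
  -- that tends to `0` as `t → ∞`, although `𝓕 g ξ` does not depend on `t`.
  have hle : ∀ t : ℝ, ‖𝓕 g ξ‖ ≤ C' *
      Real.exp (-Real.pi * (κ + t * (2 * l * β + t * ((l - 1) * a)))) := by
    intro t
    have h1 := hdec' t
    rw [hgauss t, norm_mul, Complex.norm_exp] at h1
    have h2 : (-((Real.pi * a : ℝ) : ℂ) * (t : ℂ) ^ 2).re = -(Real.pi * a) * t ^ 2 := by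
      rw [← Complex.ofReal_pow, ← Complex.ofReal_neg, ← Complex.ofReal_mul, Complex.ofReal_re]
    rw [h2, ← le_div_iff₀ (Real.exp_pos _), mul_div_assoc, ← Real.exp_sub] at h1
    refine h1.trans (le_of_eq ?_)
    congr 2
    ring
  have hlim : Filter.Tendsto (fun t : ℝ => C' *
      Real.exp (-Real.pi * (κ + t * (2 * l * β + t * ((l - 1) * a))))) Filter.atTop (nhds 0) := by
    have h1 : Filter.Tendsto (fun t : ℝ => t * (2 * l * β + t * ((l - 1) * a)))
        Filter.atTop Filter.atTop :=
      Filter.tendsto_id.atTop_mul_atTop₀ (Filter.tendsto_atTop_add_const_left _ _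
        (Filter.tendsto_id.atTop_mul_const hla))
    have h2 := (Filter.tendsto_atTop_add_const_left _ κ h1).const_mul_atTop_of_neg
      (neg_lt_zero.2 Real.pi_pos)
    simpa using (Real.tendsto_exp_atBot.comp h2).const_mul C'
  exact norm_le_zero_iff.1 (ge_of_tendsto' hlim hle)

theorem fourier_gaussian_eq_prod {ι : Type*} [Fintype ι] (b : OrthonormalBasis ι ℝ E)
    {c : ι → ℂ} (hc : ∀ i, 0 < (c i).re) (u : ι → ℂ) (ξ : E) :
    𝓕 (fun x : E => Complex.exp (-Real.pi * ∑ i, c i * ((inner ℝ (b i) x : ℝ) : ℂ) ^ 2 +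
        2 * Real.pi * ∑ i, u i * ((inner ℝ (b i) x : ℝ) : ℂ))) ξ =
      (∏ i, (1 / c i) ^ (1 / 2 : ℂ)) *
        Complex.exp (Real.pi * ∑ i, (u i - Complex.I * (inner ℝ (b i) ξ : ℝ)) ^ 2 / c i) := by
  have h := integral_cexp_neg_sum_inner b (c := fun i => Real.pi * c i)
    (fun i => by simpa using mul_pos Real.pi_pos (hc i))
    (fun i => 2 * Real.pi * (u i - Complex.I * (inner ℝ (b i) ξ : ℝ)))
  rw [Finset.prod_mul_distrib, ← Complex.exp_sum] at h
  have hpi : (Real.pi : ℂ) ≠ 0 := by exact_mod_cast Real.pi_ne_zero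
  have hc0 : ∀ i, c i ≠ 0 := fun i h0 => by simpa [h0] using hc i
  rw [Real.fourier_eq']
  convert h using 1
  · refine integral_congr_ae (Filter.Eventually.of_forall fun x => ?_)
    simp only [smul_eq_mul]
    rw [← Complex.exp_add, ← b.sum_inner_mul_inner x ξ]
    congr 1
    push_cast
    simp only [Finset.mul_sum, Finset.sum_mul, ← Finset.sum_neg_distrib, ← Finset.sum_add_distrib]
    refine Finset.sum_congr rfl fun i _ => ?_
    rw [real_inner_comm x]
    ring
  · congr 1
    · refine Finset.prod_congr rfl fun i _ => ?_
      congr 1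
      field_simp
    · congr 1
      rw [Finset.mul_sum]
      refine Finset.sum_congr rfl fun i _ => ?_
      have := hc0 i
      field_simp
      ring

/-- The transform is a multiple of `e^{-π M⁻¹ζ·ζ}`. Evaluating at `ζ = Mu` avoids the inverse and
fits the lines in direction `Mu`. -/
theorem exists_fourier_gaussian {M : E →ₗ[ℝ] E} (hM : M.IsSymmetric)
    (hpos : ∀ x, x ≠ 0 → 0 < inner ℝ (M x) x) :
    ∃ κ : ℂ, κ ≠ 0 ∧ ∀ u, 𝓕 (fun x => Complex.exp (-Real.pi * (inner ℝ (M x) x : ℝ))) (M u) =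
      κ * Complex.exp (-Real.pi * (inner ℝ (M u) u : ℝ)) := by
  obtain ⟨b, p, h⟩ := hM.exists_orthonormalBasis
  have hp : ∀ i, 0 < p i := fun i => by
    have := hpos (b i) (b.orthonormal.ne_zero i)
    rw [h, real_inner_smul_left, real_inner_self_eq_norm_sq, b.norm_eq_one] at this
    simpa using this
  refine ⟨∏ i, (1 / (p i : ℂ)) ^ (1 / 2 : ℂ), ?_, fun u => ?_⟩
  · refine Finset.prod_ne_zero_iff.2 fun i _ => ?_
    have : (1 / (p i : ℂ)) ≠ 0 := one_div_ne_zero (by exact_mod_cast (hp i).ne')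
    rw [Complex.cpow_def_of_ne_zero this]
    exact Complex.exp_ne_zero _
  have h1 := fourier_gaussian_eq_prod b (c := fun i => (p i : ℂ)) (fun i => by simpa using hp i)
    (fun _ => 0) (M u)
  convert h1 using 2
  · ext x
    rw [inner_eq_sum_of_eigenbasis hM h]
    congr 1
    push_cast
    simp [pow_two]
  · congr 1
    rw [inner_eq_sum_of_eigenbasis hM h]
    push_cast
    rw [neg_mul, ← mul_neg, ← Finset.sum_neg_distrib]
    congr 1
    refine Finset.sum_congr rfl fun i _ => ?_
    have h2 : inner ℝ (b i) (M u) = p i * inner ℝ (b i) u := by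
      rw [← hM, h, real_inner_smul_left]
    have : (p i : ℂ) ≠ 0 := by exact_mod_cast (hp i).ne'
    rw [h2, zero_sub, neg_sq, mul_pow, Complex.I_sq]
    push_cast
    field_simp

/-- Hardy's uncertainty principle, critical case. -/
theorem ae_eq_gaussian_of_hardy {M B : E →ₗ[ℝ] E} (hM : M.IsSymmetric) {κ : ℂ} (hκ : κ ≠ 0)
    (hκM : ∀ u, 𝓕 (fun x => Complex.exp (-Real.pi * (inner ℝ (M x) x : ℝ))) (M u) =
      κ * Complex.exp (-Real.pi * (inner ℝ (M u) u : ℝ))) {g : E → ℂ}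
    (hg : AEStronglyMeasurable g volume) {C m : ℝ} (hm : 0 < m)
    (hMm : ∀ x, m * ‖x‖ ^ 2 ≤ inner ℝ (M x) x)
    (hb : ∀ᵐ x, ‖g x‖ ≤ C * Real.exp (-Real.pi * inner ℝ (M x) x))
    {C' : ℝ} (hdec : ∀ ζ, ‖𝓕 g ζ‖ ≤ C' * Real.exp (-Real.pi * inner ℝ (B ζ) ζ))
    (hBM : ∀ u, B (M u) = u) :
    g =ᵐ[volume] fun x => (𝓕 g 0 / κ) * Complex.exp (-Real.pi * (inner ℝ (M x) x : ℝ)) := by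
  have hC : 0 ≤ C := by
    obtain ⟨x, hx⟩ := hb.exists
    exact nonneg_of_mul_nonneg_left ((norm_nonneg _).trans hx) (Real.exp_pos _)
  have hnorm : ∀ x : E, ‖Complex.exp (-Real.pi * (inner ℝ (M x) x : ℝ))‖ =
      Real.exp (-Real.pi * inner ℝ (M x) x) := fun x => by
    rw [← Complex.ofReal_neg, ← Complex.ofReal_mul, ← Complex.ofReal_exp, Complex.norm_real,
      Real.norm_of_nonneg (Real.exp_pos _).le]
  have hexp := exp_neg_inner_le_of_coercive hMm
  have hgi : Integrable g := integrable_of_gaussian_bound hg (mul_pos Real.pi_pos hm) (C := C) (by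
    filter_upwards [hb] with x hx
    exact hx.trans (mul_le_mul_of_nonneg_left (hexp x) hC))
  have hMi : Integrable (fun x : E => Complex.exp (-Real.pi * (inner ℝ (M x) x : ℝ))) := by
    refine integrable_of_gaussian_bound ?_ (mul_pos Real.pi_pos hm) (C := 1)
      (Filter.Eventually.of_forall fun x => ?_)
    · have := continuous_inner_map_self M
      exact (by fun_prop : Continuous _).aestronglyMeasurable
    · rw [hnorm, one_mul]; exact hexp x
  have hgauss : ∀ u, 𝓕 g (M u) = 𝓕 g 0 * Complex.exp (-Real.pi * (inner ℝ (M u) u : ℝ)) := by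
    intro u
    by_cases hu : u = 0
    · simp [hu]
    -- Because `BM = 1`, the assumed decay along the line through `0` has exactly the critical rate;
    -- `t = 1` gives the value at `Mu`.
    have h1 := fourier_line_eq_gaussian hM hg hm hMm hb 0 hu (C' := C') (fun t => by
      refine (hdec _).trans (le_of_eq ?_)
      rw [zero_add, map_smul, hBM, real_inner_smul_left, real_inner_smul_right,
        real_inner_comm (M u) u]
      ring_nf) 1
    rw [zero_add, one_smul] at h1
    rw [h1]
    congr 2
    push_cast
    ring
  refine ae_eq_of_fourier_eq hgi (hMi.const_mul _) ?_
  ext ζ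
  have hinj : Function.Injective M := fun x y hxy => by rw [← hBM x, ← hBM y, hxy]
  obtain ⟨u, rfl⟩ := LinearMap.injective_iff_surjective.1 hinj ζ
  have h2 : 𝓕 (fun x => (𝓕 g 0 / κ) * Complex.exp (-Real.pi * (inner ℝ (M x) x : ℝ))) (M u) =
      (𝓕 g 0 / κ) * 𝓕 (fun x => Complex.exp (-Real.pi * (inner ℝ (M x) x : ℝ))) (M u) := by
    generalize 𝓕 g 0 / κ = c
    rw [Real.fourier_eq', Real.fourier_eq', ← integral_const_mul]
    refine integral_congr_ae (Filter.Eventually.of_forall fun x => ?_)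
    simp only [smul_eq_mul]
    ring
  rw [hgauss, h2, hκM]
  field_simp

end Hardy

/-! ### Convolution with a nondegenerate chirp, tested on chirped Gaussians. -/

section ChirpConvolution

variable {E : Type*} [NormedAddCommGroup E] [InnerProductSpace ℝ E]

/-- A chirped, modulated Gaussian. -/
noncomputable def chirpGaussian (S : E →ₗ[ℝ] E) (w x : E) : ℂ :=
  Complex.exp (Complex.I * Real.pi * (inner ℝ (S x) x : ℝ)) *
    (Complex.exp (-Real.pi * (‖x‖ : ℂ) ^ 2) *
      Complex.exp (2 * Real.pi * Complex.I * (inner ℝ w x : ℝ)))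

/-- Up to a constant, the image of `chirpGaussian S w` under the multiplier with symbol
`e^{iπ S⁻¹ξ·ξ}`. -/
noncomputable def chirpGaussianImage (S : E →ₗ[ℝ] E) (w x : E) : ℂ :=
  Complex.exp (-Complex.I * Real.pi * (inner ℝ (S x) x : ℝ)) *
    Complex.exp (-Real.pi * (‖S x + w‖ : ℂ) ^ 2)

theorem norm_cexp_neg_pi_mul_sq (t : ℝ) :
    ‖Complex.exp (-Real.pi * (t : ℂ) ^ 2)‖ = Real.exp (-Real.pi * t ^ 2) := by
  rw [← Complex.ofReal_pow, ← Complex.ofReal_neg, ← Complex.ofReal_mul, ← Complex.ofReal_exp,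
    Complex.norm_real, Real.norm_of_nonneg (Real.exp_pos _).le]

theorem norm_cexp_I_pi_mul (t : ℝ) : ‖Complex.exp (Complex.I * Real.pi * (t : ℂ))‖ = 1 := by
  rw [mul_assoc, mul_comm, ← Complex.ofReal_mul, Complex.norm_exp_ofReal_mul_I]

theorem norm_cexp_neg_I_pi_mul (t : ℝ) : ‖Complex.exp (-Complex.I * Real.pi * (t : ℂ))‖ = 1 := by
  have := norm_cexp_I_pi_mul (-t)
  push_cast at this
  rw [mul_neg, ← neg_mul, ← neg_mul] at this
  exact this

theorem norm_chirpGaussian (S : E →ₗ[ℝ] E) (w x : E) :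
    ‖chirpGaussian S w x‖ = Real.exp (-Real.pi * ‖x‖ ^ 2) := by
  have h1 : ‖Complex.exp (2 * Real.pi * Complex.I * (inner ℝ w x : ℝ))‖ = 1 := by
    rw [Complex.norm_exp]; simp
  rw [chirpGaussian, norm_mul, norm_mul, norm_cexp_neg_pi_mul_sq, norm_cexp_I_pi_mul, h1]
  ring

theorem norm_chirpGaussianImage (S : E →ₗ[ℝ] E) (w x : E) :
    ‖chirpGaussianImage S w x‖ = Real.exp (-Real.pi * ‖S x + w‖ ^ 2) := by
  rw [chirpGaussianImage, norm_mul, norm_cexp_neg_pi_mul_sq, norm_cexp_neg_I_pi_mul, one_mul]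

variable [FiniteDimensional ℝ E]

theorem continuous_chirpGaussian (S : E →ₗ[ℝ] E) (w : E) : Continuous (chirpGaussian S w) := by
  have := continuous_inner_map_self S
  unfold chirpGaussian
  fun_prop

theorem continuous_chirpGaussianImage (S : E →ₗ[ℝ] E) (w : E) :
    Continuous (chirpGaussianImage S w) := by
  have h1 := continuous_inner_map_self S
  have h2 := S.continuous_of_finiteDimensional
  unfold chirpGaussianImage
  fun_prop

/-- Invertibility of `S` gives `‖x‖ ≤ a‖Sx‖`, and the shift by `w` costs only a constant factor. The
`+ 1` in `a` keeps it positive even if `A = 0`. -/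
theorem exists_chirpGaussianImage_le {A S : E →ₗ[ℝ] E} (hAS : ∀ x, A (S x) = x) (w : E) :
    ∃ C δ : ℝ, 0 < δ ∧ ∀ x, ‖chirpGaussianImage S w x‖ ≤ C * Real.exp (-δ * ‖x‖ ^ 2) := by
  set a := ‖LinearMap.toContinuousLinearMap A‖ + 1
  have ha : 0 < a := by positivity
  refine ⟨Real.exp (Real.pi * ‖w‖ ^ 2), Real.pi / (2 * a ^ 2), by have := Real.pi_pos; positivity,
    fun x => ?_⟩
  rw [norm_chirpGaussianImage, ← Real.exp_add]
  apply Real.exp_le_exp.2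
  have h1 : ‖x‖ ≤ a * ‖S x‖ := by
    have := (LinearMap.toContinuousLinearMap A).le_opNorm (S x)
    rw [LinearMap.coe_toContinuousLinearMap', hAS] at this
    refine this.trans ?_
    gcongr
    simp [a]
  have h2 : ‖S x‖ ≤ ‖S x + w‖ + ‖w‖ := by simpa using norm_sub_le (S x + w) w
  have h3 : ‖x‖ ^ 2 / (2 * a ^ 2) ≤ ‖S x + w‖ ^ 2 + ‖w‖ ^ 2 := by
    rw [div_le_iff₀ (by positivity)]
    calc ‖x‖ ^ 2 ≤ (a * (‖S x + w‖ + ‖w‖)) ^ 2 := by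
          gcongr; exact h1.trans (by gcongr)
      _ = a ^ 2 * (‖S x + w‖ + ‖w‖) ^ 2 := by ring
      _ ≤ a ^ 2 * (2 * (‖S x + w‖ ^ 2 + ‖w‖ ^ 2)) := by
          gcongr
          nlinarith [sq_nonneg (‖S x + w‖ - ‖w‖)]
      _ = _ := by ring
  have h4 : Real.pi / (2 * a ^ 2) * ‖x‖ ^ 2 = Real.pi * (‖x‖ ^ 2 / (2 * a ^ 2)) := by ring
  nlinarith [Real.pi_pos]

variable [MeasurableSpace E] [BorelSpace E]

/-- In an eigenbasis of `A` with eigenvalues `p i`, both functions are products of one-dimensional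
Gaussians, with complex widths `1 - i/p` and `p⁻² + i/p`. The exponents then agree coordinate by
coordinate. It matters that `c` does not depend on `w`, since `w` later becomes the frequency
variable. -/
theorem exists_fourier_chirpGaussian {A S : E →ₗ[ℝ] E} (hA : A.IsSymmetric)
    (hAS : ∀ x, A (S x) = x) (hSA : ∀ x, S (A x) = x) :
    ∃ c : ℂ, c ≠ 0 ∧ ∀ w ξ, c * 𝓕 (chirpGaussianImage S w) ξ =
      Complex.exp (Complex.I * Real.pi * (inner ℝ (A ξ) ξ : ℝ)) * 𝓕 (chirpGaussian S w) ξ := by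
  obtain ⟨b, p, h⟩ := hA.exists_orthonormalBasis
  have hS : S.IsSymmetric := fun x y => by
    rw [← hAS y, ← hA, hAS, hSA]
  have hp : ∀ i, p i ≠ 0 := fun i h0 => by
    have h1 := hSA (b i)
    rw [h, h0, zero_smul, map_zero] at h1
    exact b.orthonormal.ne_zero i h1.symm
  have hSb : ∀ i, S (b i) = (p i)⁻¹ • b i := fun i => by
    rw [eq_inv_smul_iff₀ (hp i), ← map_smul, ← h, hSA]
  have hpc : ∀ i, (p i : ℂ) ≠ 0 := fun i => by exact_mod_cast hp i
  have hnorm : ∀ x : E, ‖x‖ ^ 2 = ∑ i, (inner ℝ (b i) x) ^ 2 := fun x => by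
    rw [← real_inner_self_eq_norm_sq, ← b.sum_inner_mul_inner]
    refine Finset.sum_congr rfl fun i _ => ?_
    rw [real_inner_comm x, pow_two]
  have hnormc : ∀ x : E, (‖x‖ : ℂ) ^ 2 = ∑ i, ((inner ℝ (b i) x : ℝ) : ℂ) ^ 2 := fun x => by
    exact_mod_cast hnorm x
  have hre1 : ∀ i, 0 < ((1 : ℂ) - Complex.I * (p i : ℂ)⁻¹).re := fun i => by
    rw [← Complex.ofReal_inv]
    simp
  have hre2 : ∀ i, 0 < (((p i : ℂ)⁻¹) ^ 2 + Complex.I * (p i : ℂ)⁻¹).re := fun i => by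
    rw [← Complex.ofReal_inv, ← Complex.ofReal_pow]
    simp only [Complex.add_re, Complex.ofReal_re, Complex.mul_re, Complex.I_re, Complex.I_im,
      Complex.ofReal_im]
    have h2 : 0 < (p i)⁻¹ ^ 2 := by have := hp i; positivity
    linarith
  have hne : ∀ z : Fin (Module.finrank ℝ E) → ℂ, (∀ i, 0 < (z i).re) →
      ∏ i, (1 / z i) ^ (1 / 2 : ℂ) ≠ 0 := fun z hz =>
    Finset.prod_ne_zero_iff.2 fun i _ => by
      have h0 : z i ≠ 0 := fun h0 => by simpa [h0] using hz i
      rw [Complex.cpow_def_of_ne_zero (one_div_ne_zero h0)]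
      exact Complex.exp_ne_zero _
  refine ⟨(∏ i, (1 / ((1 : ℂ) - Complex.I * (p i : ℂ)⁻¹)) ^ (1 / 2 : ℂ)) /
    ∏ i, (1 / (((p i : ℂ)⁻¹) ^ 2 + Complex.I * (p i : ℂ)⁻¹)) ^ (1 / 2 : ℂ),
    div_ne_zero (hne _ hre1) (hne _ hre2), fun w ξ => ?_⟩
  have e1 : chirpGaussian S w = fun x : E => Complex.exp (-Real.pi * ∑ i,
      ((1 : ℂ) - Complex.I * (p i : ℂ)⁻¹) * ((inner ℝ (b i) x : ℝ) : ℂ) ^ 2 +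
      2 * Real.pi * ∑ i, (Complex.I * (inner ℝ (b i) w : ℝ)) * ((inner ℝ (b i) x : ℝ) : ℂ)) := by
    ext x
    rw [chirpGaussian, ← Complex.exp_add, ← Complex.exp_add, inner_eq_sum_of_eigenbasis hS hSb,
      hnormc, ← b.sum_inner_mul_inner w x]
    congr 1
    push_cast
    simp only [Finset.mul_sum, ← Finset.sum_add_distrib]
    refine Finset.sum_congr rfl fun i _ => ?_
    rw [real_inner_comm w]
    ring
  have e2 : chirpGaussianImage S w = fun x : E =>
      Complex.exp (-Real.pi * ∑ i, ((inner ℝ (b i) w : ℝ) : ℂ) ^ 2) *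
      Complex.exp (-Real.pi * ∑ i,
      (((p i : ℂ)⁻¹) ^ 2 + Complex.I * (p i : ℂ)⁻¹) * ((inner ℝ (b i) x : ℝ) : ℂ) ^ 2 +
      2 * Real.pi * ∑ i, (-(inner ℝ (b i) w : ℝ) * (p i : ℂ)⁻¹) *
        ((inner ℝ (b i) x : ℝ) : ℂ)) := by
    ext x
    rw [chirpGaussianImage, ← Complex.exp_add, ← Complex.exp_add,
      inner_eq_sum_of_eigenbasis hS hSb, hnormc]
    congr 1
    push_cast
    simp only [Finset.mul_sum, ← Finset.sum_add_distrib]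
    refine Finset.sum_congr rfl fun i _ => ?_
    rw [inner_add_right, ← hS, hSb, real_inner_smul_left]
    push_cast
    ring
  have e3 : 𝓕 (chirpGaussianImage S w) ξ =
      Complex.exp (-Real.pi * ∑ i, ((inner ℝ (b i) w : ℝ) : ℂ) ^ 2) *
      𝓕 (fun x : E => Complex.exp (-Real.pi * ∑ i,
      (((p i : ℂ)⁻¹) ^ 2 + Complex.I * (p i : ℂ)⁻¹) * ((inner ℝ (b i) x : ℝ) : ℂ) ^ 2 +
      2 * Real.pi * ∑ i, (-(inner ℝ (b i) w : ℝ) * (p i : ℂ)⁻¹) *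
        ((inner ℝ (b i) x : ℝ) : ℂ))) ξ := by
    rw [e2, Real.fourier_eq', Real.fourier_eq', ← integral_const_mul]
    refine integral_congr_ae (Filter.Eventually.of_forall fun x => ?_)
    simp only [smul_eq_mul]
    ring
  rw [e3, e1, fourier_gaussian_eq_prod b hre1, fourier_gaussian_eq_prod b hre2,
    inner_eq_sum_of_eigenbasis hA h]
  set X := ∏ i, (1 / ((1 : ℂ) - Complex.I * (p i : ℂ)⁻¹)) ^ (1 / 2 : ℂ)
  have hY := hne _ hre2
  set Y := ∏ i, (1 / (((p i : ℂ)⁻¹) ^ 2 + Complex.I * (p i : ℂ)⁻¹)) ^ (1 / 2 : ℂ)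
  have e4 : ∀ a b c d : ℂ, a + b = c + d →
      X / Y * (Complex.exp a * (Y * Complex.exp b)) =
        Complex.exp c * (X * Complex.exp d) := fun a b c d hab => by
    have : Complex.exp a * Complex.exp b = Complex.exp c * Complex.exp d := by
      rw [← Complex.exp_add, ← Complex.exp_add, hab]
    calc _ = X * (Complex.exp a * Complex.exp b) := by field_simp
      _ = _ := by rw [this]; ring
  apply e4
  push_cast
  simp only [Finset.mul_sum, ← Finset.sum_add_distrib]
  refine Finset.sum_congr rfl fun i _ => ?_
  have hq1 : (1 : ℂ) - Complex.I * (p i : ℂ)⁻¹ ≠ 0 := fun h0 => by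
    simpa [h0] using hre1 i
  have hq2 : ((p i : ℂ)⁻¹) ^ 2 + Complex.I * (p i : ℂ)⁻¹ ≠ 0 := fun h0 => by
    have := hre2 i
    rw [h0, Complex.zero_re] at this
    exact lt_irrefl _ this
  have hpi := hpc i
  have hq3 : (1 : ℂ) + Complex.I * p i ≠ 0 := fun h0 => hq2 (by
    field_simp
    linear_combination h0)
  have r1 : (1 : ℂ) - Complex.I * (p i : ℂ)⁻¹ = (1 + Complex.I * p i) / (Complex.I * p i) := by
    have := Complex.I_ne_zero
    field_simp
    linear_combination -Complex.I_sq
  have r2 : ((p i : ℂ)⁻¹) ^ 2 + Complex.I * (p i : ℂ)⁻¹ =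
      (1 + Complex.I * p i) / (p i : ℂ) ^ 2 := by
    field_simp
  rw [r1, r2]
  have := Complex.I_ne_zero
  generalize ((inner ℝ (b i) w : ℝ) : ℂ) = y
  generalize ((inner ℝ (b i) ξ : ℝ) : ℂ) = x
  clear r1 r2 hq1 hq2
  generalize hq : 1 + Complex.I * (p i : ℂ) = q at *
  field_simp
  rw [← hq]
  ring_nf
  simp only [Complex.I_sq, Complex.I_pow_three]
  ring

/-- A pairing identity against all chirped Gaussians determines the output of the convolution with
a chirp. -/
theorem ae_eq_fourier_comp_of_pairing {S : E →ₗ[ℝ] E} (hS : S.IsSymmetric) {f h : E → ℂ}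
    (hf : Integrable f) (hh : Integrable h) (c : ℂ) {D : Set E} (hD : Dense D)
    (hpair : ∀ w ∈ D, ∫ x, star (chirpGaussian S w x) * h x =
      ∫ x, star (c * chirpGaussianImage S w x) * f x) :
    (fun x => Complex.exp (-Complex.I * Real.pi * (inner ℝ (S x) x : ℝ)) * h x) =ᵐ[volume]
      fun x => star c *
        𝓕 (fun y => Complex.exp (Complex.I * Real.pi * (inner ℝ (S y) y : ℝ)) * f y) (S x) := by
  set g : E → ℂ := fun y => Complex.exp (Complex.I * Real.pi * (inner ℝ (S y) y : ℝ)) * f y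
  set k : E → ℂ := fun x => Complex.exp (-Complex.I * Real.pi * (inner ℝ (S x) x : ℝ)) * h x
  set γ : E → ℂ := fun x => Complex.exp (-Real.pi * (‖x‖ : ℂ) ^ 2)
  have hSc := S.continuous_of_finiteDimensional
  have hqc := continuous_inner_map_self S
  have hg : Integrable g := by
    refine hf.norm.mono' (AEStronglyMeasurable.mul
      (by fun_prop : Continuous _).aestronglyMeasurable hf.1)
      (Filter.Eventually.of_forall fun x => ?_)
    rw [norm_mul, norm_cexp_I_pi_mul, one_mul]
  have hk : Integrable k := by
    refine hh.norm.mono' (AEStronglyMeasurable.mul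
      (by fun_prop : Continuous _).aestronglyMeasurable hh.1)
      (Filter.Eventually.of_forall fun x => ?_)
    rw [norm_mul, norm_cexp_neg_I_pi_mul, one_mul]
  have hγc : Continuous γ := by fun_prop
  have hγn : ∀ x, ‖γ x‖ = Real.exp (-Real.pi * ‖x‖ ^ 2) := fun x => norm_cexp_neg_pi_mul_sq _
  have hγ : Integrable γ := integrable_of_gaussian_bound hγc.aestronglyMeasurable Real.pi_pos
    (C := 1) (Filter.Eventually.of_forall fun x => by rw [hγn, one_mul])
  have hγ1 : ∀ x, ‖γ x‖ ≤ 1 := fun x => by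
    rw [hγn, Real.exp_le_one_iff]
    nlinarith [Real.pi_pos, sq_nonneg ‖x‖]
  have hGc : Continuous (𝓕 g) := continuous_fourier hg
  have hγk : Integrable (fun x => γ x * k x) := by
    refine hk.norm.mono' (hγc.aestronglyMeasurable.mul hk.1)
      (Filter.Eventually.of_forall fun x => ?_)
    rw [norm_mul]
    exact mul_le_of_le_one_left (norm_nonneg _) (hγ1 x)
  have hγG : Integrable (fun x => γ x * (star c * 𝓕 g (S x))) := by
    refine (hγ.norm.mul_const (‖c‖ * ∫ x, ‖g x‖)).mono'
      (by fun_prop : Continuous _).aestronglyMeasurable (Filter.Eventually.of_forall fun x => ?_)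
    rw [norm_mul, norm_mul, norm_star]
    gcongr
    exact VectorFourier.norm_fourierIntegral_le_integral_norm _ _ _ _ _
  have hγγ : ∀ v : E, 𝓕 γ v = γ v := fun v => by
    have := fourier_gaussian_innerProductSpace (V := E) (b := Real.pi)
      (by simpa using Real.pi_pos) v
    have hpi : (Real.pi : ℂ) ≠ 0 := by exact_mod_cast Real.pi_ne_zero
    simp only [γ]
    rw [this, div_self hpi, Complex.one_cpow, one_mul]
    congr 1
    field_simp
  -- The chirp in the test function cancels that of the kernel formula, and its modulation makes the
  -- pairing a Fourier transform in `w`.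
  have hL : ∀ w, 𝓕 (fun x => γ x * k x) w = ∫ x, star (chirpGaussian S w x) * h x := by
    intro w
    rw [Real.fourier_eq']
    refine integral_congr_ae (Filter.Eventually.of_forall fun x => ?_)
    simp only [smul_eq_mul, γ, k, chirpGaussian, Complex.star_def, map_mul, ← Complex.exp_conj,
      Complex.conj_I, Complex.conj_ofReal, map_neg, map_pow, map_ofNat]
    rw [real_inner_comm]
    push_cast
    rw [show (-2 * (Real.pi : ℂ) * (inner ℝ w x : ℝ) * Complex.I) =
      2 * Real.pi * -Complex.I * (inner ℝ w x : ℝ) by ring]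
    ring
  -- Writing `γ(Sx + w)` as the Fourier integral of the self-dual Gaussian `γ` and exchanging
  -- integrals moves the transform onto `g`, again as a function of the frequency `w`.
  have hR : ∀ w, 𝓕 (fun x => γ x * (star c * 𝓕 g (S x))) w =
      ∫ x, star (c * chirpGaussianImage S w x) * f x := by
    intro w
    have hmodn : ∀ y : E, ‖Complex.exp (-2 * Real.pi * Complex.I * (inner ℝ y w : ℝ))‖ = 1 :=
      fun y => by rw [Complex.norm_exp]; simp
    have hk2 : Integrable (fun y : E =>
        Complex.exp (-2 * Real.pi * Complex.I * (inner ℝ y w : ℝ)) * γ y) :=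
      hγ.norm.mono' (by fun_prop : Continuous _).aestronglyMeasurable
        (Filter.Eventually.of_forall fun y => by rw [norm_mul, hmodn, one_mul])
    have hflip := VectorFourier.integral_fourierIntegral_smul_eq_flip
      (μ := (volume : Measure E)) (ν := (volume : Measure E)) (L := (innerₗ E).comp S)
      Real.continuous_fourierChar
      (by exact (hSc.comp continuous_fst).inner continuous_snd) hg hk2
    have h1 : ∀ y, VectorFourier.fourierIntegral Real.fourierChar volume ((innerₗ E).comp S) g y =
        𝓕 g (S y) := fun y => by
      rw [Real.fourier_eq, VectorFourier.fourierIntegral]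
      refine integral_congr_ae (Filter.Eventually.of_forall fun x => ?_)
      simp only [LinearMap.comp_apply, innerₗ_apply_apply]
      rw [hS]
    have h2 : ∀ x, VectorFourier.fourierIntegral Real.fourierChar volume ((innerₗ E).comp S).flip
        (fun y : E => Complex.exp (-2 * Real.pi * Complex.I * (inner ℝ y w : ℝ)) * γ y) x =
        γ (S x + w) := fun x => by
      rw [← hγγ, Real.fourier_eq', VectorFourier.fourierIntegral]
      refine integral_congr_ae (Filter.Eventually.of_forall fun y => ?_)
      simp only [LinearMap.flip_apply, LinearMap.comp_apply, innerₗ_apply_apply, Circle.smul_def,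
        Real.fourierChar_apply, smul_eq_mul]
      rw [← mul_assoc, ← Complex.exp_add, inner_add_right, real_inner_comm y]
      congr 2
      push_cast
      ring
    simp only [h1, h2] at hflip
    calc _ = star c * ∫ y, 𝓕 g (S y) •
          (Complex.exp (-2 * Real.pi * Complex.I * (inner ℝ y w : ℝ)) * γ y) := by
          rw [Real.fourier_eq', ← integral_const_mul]
          refine integral_congr_ae (Filter.Eventually.of_forall fun y => ?_)
          simp only [smul_eq_mul]
          push_cast
          rw [show (-2 * (Real.pi : ℂ) * (inner ℝ y w : ℝ) * Complex.I) =
            -2 * Real.pi * Complex.I * (inner ℝ y w : ℝ) by ring]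
          ring
      _ = _ := by
          rw [hflip, ← integral_const_mul]
          refine integral_congr_ae (Filter.Eventually.of_forall fun x => ?_)
          simp only [smul_eq_mul, γ, g, chirpGaussianImage, Complex.star_def, map_mul,
            ← Complex.exp_conj, Complex.conj_I, Complex.conj_ofReal, map_neg, map_pow, neg_neg]
          ring
  -- Both sides are continuous in `w`, so agreement on the dense set `D` suffices. The common
  -- Gaussian factor, which never vanishes, is cancelled afterwards.
  have heq : 𝓕 (fun x => γ x * k x) = 𝓕 (fun x => γ x * (star c * 𝓕 g (S x))) :=
    (continuous_fourier hγk).ext_on hD (continuous_fourier hγG)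
      (fun w hw => by rw [hL, hR, hpair w hw])
  filter_upwards [ae_eq_of_fourier_eq hγk hγG heq] with x hx
  exact mul_left_cancel₀ (Complex.exp_ne_zero _) hx

end ChirpConvolution

/-! ### Fubini along a subspace and its orthogonal complement. -/

section Slices

variable {V : Type*} [NormedAddCommGroup V] [InnerProductSpace ℝ V] [FiniteDimensional ℝ V]
  [MeasurableSpace V] [BorelSpace V]

/-- The splitting `x ↦ (x₂, x₁)` along a subspace and its orthogonal complement. -/
noncomputable def orthogonalSplit (K : Submodule ℝ V) : V ≃ᵐ K × Kᗮ :=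
  K.orthogonalDecomposition.toMeasurableEquiv.trans (MeasurableEquiv.toLp 2 (K × Kᗮ)).symm

theorem orthogonalSplit_apply (K : Submodule ℝ V) (x : V) :
    orthogonalSplit K x = (K.orthogonalProjectionOnto x, Kᗮ.orthogonalProjectionOnto x) := by
  simp [orthogonalSplit]

omit [MeasurableSpace V] [BorelSpace V] in
theorem projectionOnto_add_of_mem {K : Submodule ℝ V} (z : K) (y : Kᗮ) :
    K.orthogonalProjectionOnto ((z : V) + y) = z := by
  rw [map_add, Submodule.orthogonalProjectionOnto_mem_subspace_eq_self,
    Submodule.orthogonalProjectionOnto_apply_of_mem_orthogonal y.2, add_zero]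

omit [MeasurableSpace V] [BorelSpace V] in
theorem projectionOnto_orthogonal_add_of_mem {K : Submodule ℝ V} (z : K) (y : Kᗮ) :
    Kᗮ.orthogonalProjectionOnto ((z : V) + y) = y := by
  rw [map_add, Submodule.orthogonalProjectionOnto_mem_subspace_eq_self,
    Submodule.orthogonalProjectionOnto_apply_of_mem_orthogonal
      (K.le_orthogonal_orthogonal z.2), zero_add]

theorem orthogonalSplit_symm_apply (K : Submodule ℝ V) (p : K × Kᗮ) :
    (orthogonalSplit K).symm p = (p.1 : V) + p.2 := by
  rw [MeasurableEquiv.symm_apply_eq, orthogonalSplit_apply, projectionOnto_add_of_mem,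
    projectionOnto_orthogonal_add_of_mem]

theorem measurePreserving_orthogonalSplit (K : Submodule ℝ V) :
    MeasurePreserving (orthogonalSplit K) volume (volume.prod volume) :=
  K.orthogonalDecomposition.measurePreserving.trans
    (WithLp.volume_preserving_symm_measurableEquiv_toLp_prod K Kᗮ)

theorem measurePreserving_orthogonal_add (K : Submodule ℝ V) :
    MeasurePreserving (fun p : K × Kᗮ => (p.1 : V) + p.2) (volume.prod volume) volume := by
  rw [← funext (orthogonalSplit_symm_apply K)]
  exact (measurePreserving_orthogonalSplit K).symm

theorem ae_ae_orthogonal_add {K : Submodule ℝ V} {p : V → Prop} (h : ∀ᵐ x, p x) :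
    ∀ᵐ z : K, ∀ᵐ y : Kᗮ, p ((z : V) + y) :=
  Measure.ae_ae_of_ae_prod ((measurePreserving_orthogonal_add K).quasiMeasurePreserving.ae h)

theorem ae_of_ae_orthogonal_add {K : Submodule ℝ V} {p : K × Kᗮ → Prop}
    (h : ∀ᵐ q ∂(volume.prod volume : Measure (K × Kᗮ)), p q) :
    ∀ᵐ x : V, p (K.orthogonalProjectionOnto x, Kᗮ.orthogonalProjectionOnto x) := by
  have := (measurePreserving_orthogonalSplit K).quasiMeasurePreserving.ae h
  simpa only [orthogonalSplit_apply] using this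

/-- The tensor product of functions on a subspace and on its orthogonal complement. -/
noncomputable def orthogonalTensor {K : Submodule ℝ V} (χ : K → ℂ) (φ : Kᗮ → ℂ) (x : V) : ℂ :=
  χ (K.orthogonalProjectionOnto x) * φ (Kᗮ.orthogonalProjectionOnto x)

theorem orthogonalTensor_eq {K : Submodule ℝ V} (χ : K → ℂ) (φ : Kᗮ → ℂ) :
    orthogonalTensor χ φ = (fun p : K × Kᗮ => χ p.1 * φ p.2) ∘ orthogonalSplit K := by
  ext x
  simp [orthogonalTensor, orthogonalSplit_apply]

theorem integrable_orthogonalTensor {K : Submodule ℝ V} {χ : K → ℂ} {φ : Kᗮ → ℂ}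
    (hχ : Integrable χ) (hφ : Integrable φ) : Integrable (orthogonalTensor χ φ) := by
  rw [orthogonalTensor_eq]
  exact (measurePreserving_orthogonalSplit K).integrable_comp_of_integrable (hχ.mul_prod hφ)

theorem memLp_orthogonalTensor {K : Submodule ℝ V} {χ : K → ℂ} {φ : Kᗮ → ℂ}
    (hχ : MemLp χ 2) (hφ : MemLp φ 2) : MemLp (orthogonalTensor χ φ) 2 := by
  rw [orthogonalTensor_eq]
  refine MemLp.comp_measurePreserving ?_ (measurePreserving_orthogonalSplit K)
  have hm : AEStronglyMeasurable (fun p : K × Kᗮ => χ p.1 * φ p.2) (volume.prod volume) :=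
    hχ.1.comp_fst.mul hφ.1.comp_snd
  rw [memLp_two_iff_integrable_sq_norm hm]
  refine (((memLp_two_iff_integrable_sq_norm hχ.1).1 hχ).mul_prod
    ((memLp_two_iff_integrable_sq_norm hφ.1).1 hφ)).congr
    (Filter.Eventually.of_forall fun p => ?_)
  simp only [norm_mul]
  ring

theorem integral_comp_orthogonal_add {K : Submodule ℝ V} (u : V → ℂ) :
    ∫ p, u ((p.1 : V) + p.2) ∂(volume.prod volume : Measure (K × Kᗮ)) = ∫ x, u x := by
  rw [← (measurePreserving_orthogonalSplit K).symm.integral_comp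
    (orthogonalSplit K).symm.measurableEmbedding]
  simp only [orthogonalSplit_symm_apply]

theorem fourier_orthogonalTensor {K : Submodule ℝ V} (χ : K → ℂ) (φ : Kᗮ → ℂ) (ξ : V) :
    𝓕 (orthogonalTensor χ φ) ξ =
      𝓕 χ (K.orthogonalProjectionOnto ξ) * 𝓕 φ (Kᗮ.orthogonalProjectionOnto ξ) := by
  simp only [Real.fourier_eq']
  rw [← integral_prod_mul, ← integral_comp_orthogonal_add (K := K)]
  refine integral_congr_ae (Filter.Eventually.of_forall fun p => ?_)
  simp only [smul_eq_mul, orthogonalTensor, projectionOnto_add_of_mem,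
    projectionOnto_orthogonal_add_of_mem]
  have h1 : inner ℝ ((p.1 : V) + p.2) ξ = inner ℝ p.1 (K.orthogonalProjectionOnto ξ) +
      inner ℝ p.2 (Kᗮ.orthogonalProjectionOnto ξ) := by
    rw [inner_add_left, Submodule.inner_orthogonalProjectionOnto_eq_of_mem_left,
      Submodule.inner_orthogonalProjectionOnto_eq_of_mem_left]
  rw [h1, mul_mul_mul_comm, ← Complex.exp_add]
  congr 2
  push_cast
  ring

theorem integrable_slice_pairing {K : Submodule ℝ V} {u : V → ℂ} (hu : MemLp u 2) {φ : Kᗮ → ℂ}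
    (hφ : MemLp φ 2) {s : Set K} (hs : MeasurableSet s) (hs' : volume s < ∞) :
    Integrable (fun p : K × Kᗮ => s.indicator (fun _ => (1 : ℂ)) p.1 *
      (star (φ p.2) * u ((p.1 : V) + p.2))) (volume.prod volume) := by
  have hχ : MemLp (s.indicator fun _ => (1 : ℂ)) 2 (volume : Measure K) :=
    memLp_indicator_const 2 hs 1 (Or.inr hs'.ne)
  have h1 : Integrable (fun x => star (orthogonalTensor (s.indicator fun _ => (1 : ℂ)) φ x) * u x) :=
    MemLp.integrable_mul (p := 2) (q := 2) (memLp_orthogonalTensor hχ hφ).star hu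
  refine ((measurePreserving_orthogonal_add K).integrable_comp_of_integrable h1).congr
    (Filter.Eventually.of_forall fun p => ?_)
  simp only [Function.comp_apply, orthogonalTensor, projectionOnto_add_of_mem,
    projectionOnto_orthogonal_add_of_mem, star_mul']
  by_cases hp : p.1 ∈ s <;> simp [hp]

theorem integrableOn_slice_pairing {K : Submodule ℝ V} {u : V → ℂ} (hu : MemLp u 2) {φ : Kᗮ → ℂ}
    (hφ : MemLp φ 2) {s : Set K} (hs : MeasurableSet s) (hs' : volume s < ∞) :
    IntegrableOn (fun z : K => ∫ y, star (φ y) * u ((z : V) + y)) s := by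
  have h := (integrable_slice_pairing hu hφ hs hs').integral_prod_left
  rw [← integrable_indicator_iff hs]
  refine h.congr (Filter.Eventually.of_forall fun z => ?_)
  simp only
  rw [integral_const_mul]
  by_cases hz : z ∈ s <;> simp [hz]

theorem setIntegral_slice_pairing {K : Submodule ℝ V} {u : V → ℂ} (hu : MemLp u 2) {φ : Kᗮ → ℂ}
    (hφ : MemLp φ 2) {s : Set K} (hs : MeasurableSet s) (hs' : volume s < ∞) :
    ∫ z in s, ∫ y, star (φ y) * u ((z : V) + y) =
      ∫ x, star (orthogonalTensor (s.indicator fun _ => (1 : ℂ)) φ x) * u x := by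
  rw [← integral_comp_orthogonal_add (K := K)]
  have h := integral_prod _ (integrable_slice_pairing hu hφ hs hs')
  rw [← integral_indicator hs]
  refine Eq.trans ?_ (h.symm.trans ?_)
  · refine integral_congr_ae (Filter.Eventually.of_forall fun z => ?_)
    simp only
    rw [integral_const_mul]
    by_cases hz : z ∈ s <;> simp [hz]
  · refine integral_congr_ae (Filter.Eventually.of_forall fun p => ?_)
    simp only [orthogonalTensor, projectionOnto_add_of_mem,
      projectionOnto_orthogonal_add_of_mem, star_mul']
    by_cases hp : p.1 ∈ s <;> simp [hp]

/-- Taking `χ` to be the indicator of a set of finite measure, the hypothesis says that the two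
functions of `z` have equal integrals over that set, which determines them almost everywhere. -/
theorem ae_slice_pairing_eq {K : Submodule ℝ V} {u v : V → ℂ} (hu : MemLp u 2) (hv : MemLp v 2)
    {φ ψ : Kᗮ → ℂ} (hφ : MemLp φ 2) (hψ : MemLp ψ 2)
    (h : ∀ χ : K → ℂ, Integrable χ → MemLp χ 2 →
      ∫ x, star (orthogonalTensor χ φ x) * u x = ∫ x, star (orthogonalTensor χ ψ x) * v x) :
    ∀ᵐ z : K, ∫ y, star (φ y) * u ((z : V) + y) = ∫ y, star (ψ y) * v ((z : V) + y) := by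
  refine ae_eq_of_forall_setIntegral_eq_of_sigmaFinite
    (fun s hs hs' => integrableOn_slice_pairing hu hφ hs hs')
    (fun s hs hs' => integrableOn_slice_pairing hv hψ hs hs') fun s hs hs' => ?_
  rw [setIntegral_slice_pairing hu hφ hs hs', setIntegral_slice_pairing hv hψ hs hs']
  exact h _ ((integrable_indicator_iff hs).2 (integrableOn_const hs'.ne))
    (memLp_indicator_const 2 hs 1 (Or.inr hs'.ne))

end Slices

/-! ### The adjoint of the multiplier. -/

theorem star_chirp {d : ℕ} (Q : Matrix (Fin d) (Fin d) ℝ) (t : Euc d) :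
    star (chirp Q t) = chirp (-Q) t := by
  simp only [chirp, Complex.star_def, ← Complex.exp_conj, map_mul, Complex.conj_I,
    Complex.conj_ofReal, quadForm, map_neg, LinearMap.neg_apply, inner_neg_left]
  congr 1
  push_cast
  ring

/-- By Plancherel, conjugating the symbol transfers the multiplier to the test function, where it
can be computed explicitly. -/
theorem inner_metMultiplier {d : ℕ} {P : Matrix (Fin d) (Fin d) ℝ} {φ ψ : L2Euc d}
    (h : (fun t => chirp P t * (𝓕 φ : L2Euc d) t) =ᵐ[volume] (𝓕 ψ : L2Euc d)) (f : L2Euc d) :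
    inner ℂ φ (metMultiplier P f) = inner ℂ ψ f := by
  rw [metMultiplier, ← Lp.inner_fourier_eq φ, ← Lp.inner_fourier_eq ψ, fourier_fourierInv_eq,
    L2.inner_def, L2.inner_def]
  refine integral_congr_ae ?_
  filter_upwards [h, (memLp_chirp_mul (-P) (𝓕 f)).coeFn_toLp] with t h1 h2
  rw [h2, ← h1]
  simp only [RCLike.inner_apply, map_mul]
  have := star_chirp P t
  rw [Complex.star_def] at this
  rw [this]
  ring

/-! ### Semidefinite matrices, Moore–Penrose inverses and compression to `Kᗮ`. -/

section Matrices

variable {d : ℕ}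

theorem toEuclideanLin_mul_apply (A B : Matrix (Fin d) (Fin d) ℝ) (x : Euc d) :
    Matrix.toEuclideanLin (A * B) x = Matrix.toEuclideanLin A (Matrix.toEuclideanLin B x) := by
  rw [Matrix.toLpLin_mul_same, LinearMap.comp_apply]

theorem Matrix.IsSymm.isSymmetric_toEuclideanLin {A : Matrix (Fin d) (Fin d) ℝ} (hA : A.IsSymm) :
    (Matrix.toEuclideanLin A).IsSymmetric := by
  rw [Matrix.isSymmetric_toEuclideanLin_iff, Matrix.IsHermitian,
    Matrix.conjTranspose_eq_transpose_of_trivial]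
  exact hA

theorem Matrix.PosSemidef.isSymm_real {A : Matrix (Fin d) (Fin d) ℝ} (hA : A.PosSemidef) :
    A.IsSymm := by
  have := hA.isHermitian
  rwa [Matrix.IsHermitian, Matrix.conjTranspose_eq_transpose_of_trivial] at this

theorem Matrix.PosSemidef.exists_adjoint_mul {A : Matrix (Fin d) (Fin d) ℝ} (hA : A.PosSemidef) :
    ∃ L : Matrix (Fin d) (Fin d) ℝ, A = L.transpose * L := by
  open scoped MatrixOrder in
  obtain ⟨B, hB⟩ := CStarAlgebra.nonneg_iff_eq_star_mul_self.mp hA.nonneg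
  exact ⟨B, by rw [hB, Matrix.star_eq_conjTranspose, Matrix.conjTranspose_eq_transpose_of_trivial]⟩

theorem inner_toEuclideanLin_transpose (L : Matrix (Fin d) (Fin d) ℝ) (x y : Euc d) :
    inner ℝ (Matrix.toEuclideanLin L.transpose x) y = inner ℝ x (Matrix.toEuclideanLin L y) := by
  rw [← Matrix.conjTranspose_eq_transpose_of_trivial,
    Matrix.toEuclideanLin_conjTranspose_eq_adjoint, LinearMap.adjoint_inner_left]

theorem Matrix.PosSemidef.toEuclideanLin_eq_zero {A : Matrix (Fin d) (Fin d) ℝ}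
    (hA : A.PosSemidef) {x : Euc d} (hx : quadForm A x ≤ 0) : Matrix.toEuclideanLin A x = 0 := by
  obtain ⟨L, rfl⟩ := hA.exists_adjoint_mul
  rw [quadForm, toEuclideanLin_mul_apply, inner_toEuclideanLin_transpose,
    real_inner_self_eq_norm_sq] at hx
  have : ‖Matrix.toEuclideanLin L x‖ = 0 :=
    pow_eq_zero_iff two_ne_zero |>.1 (le_antisymm hx (by positivity))
  rw [toEuclideanLin_mul_apply, norm_eq_zero.1 this, map_zero]

theorem quadForm_nonneg {A : Matrix (Fin d) (Fin d) ℝ} (hA : A.PosSemidef) (x : Euc d) :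
    0 ≤ quadForm A x := by
  obtain ⟨L, rfl⟩ := hA.exists_adjoint_mul
  rw [quadForm, toEuclideanLin_mul_apply, inner_toEuclideanLin_transpose,
    real_inner_self_eq_norm_sq]
  positivity

/-- If all positive eigenvalues of a product of two positive semidefinite matrices are equal to
one, then the product is idempotent up to the left factor. -/
theorem mul_mul_eq_of_eigenvalues {M B : Matrix (Fin d) (Fin d) ℝ} (hM : M.PosSemidef)
    (hB : B.PosSemidef)
    (h : ∀ μ : ℝ, 0 < μ → Module.End.HasEigenvalue (Matrix.toEuclideanLin (M * B)) μ → μ = 1) :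
    M * B * M * B * M = M * B * M := by
  obtain ⟨L, rfl⟩ := hM.exists_adjoint_mul
  -- With `M = LᵀL`, the map `Lᵀ` carries eigenvectors of `L B Lᵀ` with nonzero eigenvalue to
  -- eigenvectors of `M B`. The symmetric matrix `L B Lᵀ` therefore has eigenvalues in `{0, 1}` and
  -- is a projection.
  have hT : (L * B * L.transpose).PosSemidef := by
    have := hB.mul_mul_conjTranspose_same L
    rwa [Matrix.conjTranspose_eq_transpose_of_trivial] at this
  obtain ⟨b, p, hp⟩ := hT.isSymm_real.isSymmetric_toEuclideanLin.exists_orthonormalBasis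
  have hsq : ∀ i, p i * p i = p i := by
    intro i
    by_cases h0 : p i = 0
    · simp [h0]
    have hpos : 0 < p i := by
      have h1 := quadForm_nonneg hT (b i)
      rw [quadForm, hp, real_inner_smul_left, real_inner_self_eq_norm_sq, b.norm_eq_one] at h1
      exact lt_of_le_of_ne (by simpa using h1) (Ne.symm h0)
    have hne : Matrix.toEuclideanLin L.transpose (b i) ≠ 0 := fun h1 => by
      have h2 := hp i
      rw [toEuclideanLin_mul_apply, h1, map_zero] at h2
      exact (smul_ne_zero h0 (b.orthonormal.ne_zero i)) h2.symm
    have heig : Module.End.HasEigenvalue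
        (Matrix.toEuclideanLin (L.transpose * L * B)) (p i) :=
      Module.End.hasEigenvalue_of_hasEigenvector
        (x := Matrix.toEuclideanLin L.transpose (b i))
        (Module.End.hasEigenvector_iff.2 ⟨Module.End.mem_eigenspace_iff.2 (by
          rw [← map_smul, ← hp, ← toEuclideanLin_mul_apply, ← toEuclideanLin_mul_apply]
          simp only [Matrix.mul_assoc]), hne⟩)
    rw [h _ hpos heig, one_mul]
  have hTT : (L * B * L.transpose) * (L * B * L.transpose) = L * B * L.transpose := by
    apply (Matrix.toEuclideanLin (𝕜 := ℝ) (m := Fin d) (n := Fin d)).injective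
    refine b.toBasis.ext fun i => ?_
    rw [b.coe_toBasis, toEuclideanLin_mul_apply, hp, map_smul, hp, smul_smul, hsq]
  have := congrArg (fun X => L.transpose * X * L) hTT
  simpa only [Matrix.mul_assoc] using this

/-- The Penrose equations for a symmetric `P` are stable under transposing the inverse, so
uniqueness applies. -/
theorem moorePenrose_isSymm {P : Matrix (Fin d) (Fin d) ℝ} (hP : P.IsSymm) :
    (moorePenrose P).IsSymm := by
  have h := isMoorePenrose_moorePenrose P
  refine IsMoorePenrose.unique (A := P) ⟨?_, ?_, ?_, ?_⟩ h
  · have := congrArg Matrix.transpose h.mul_mul_self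
    simpa only [Matrix.transpose_mul, hP.eq, Matrix.mul_assoc] using this
  · have := congrArg Matrix.transpose h.mul_mul_inv
    simpa only [Matrix.transpose_mul, hP.eq, Matrix.mul_assoc] using this
  · have := h.symm_right
    simp only [Matrix.transpose_mul, hP.eq, Matrix.transpose_transpose] at this ⊢
    exact this.symm
  · have := h.symm_left
    simp only [Matrix.transpose_mul, hP.eq, Matrix.transpose_transpose] at this ⊢
    exact this.symm

theorem moorePenrose_mul_comm {P : Matrix (Fin d) (Fin d) ℝ} (hP : P.IsSymm) :
    moorePenrose P * P = P * moorePenrose P := by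
  have h := (isMoorePenrose_moorePenrose P).symm_right
  rw [Matrix.transpose_mul, hP.eq, (moorePenrose_isSymm hP).eq] at h
  exact h.symm

theorem matKer_le_matKer_moorePenrose {P : Matrix (Fin d) (Fin d) ℝ} (hP : P.IsSymm) :
    matKer P ≤ matKer (moorePenrose P) := by
  intro x hx
  rw [matKer, LinearMap.mem_ker] at hx ⊢
  rw [← (isMoorePenrose_moorePenrose P).mul_mul_inv, Matrix.mul_assoc, ← moorePenrose_mul_comm hP,
    ← Matrix.mul_assoc, toEuclideanLin_mul_apply, hx, map_zero]

theorem toEuclideanLin_mem_orthogonal {A : Matrix (Fin d) (Fin d) ℝ} (hA : A.IsSymm)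
    {K : Submodule ℝ (Euc d)} (hK : K ≤ matKer A) (x : Euc d) :
    Matrix.toEuclideanLin A x ∈ Kᗮ := by
  intro z hz
  have h0 : Matrix.toEuclideanLin A z = 0 := hK hz
  rw [← hA.isSymmetric_toEuclideanLin, h0, inner_zero_left]

theorem eq_of_mem_orthogonal_matKer {P : Matrix (Fin d) (Fin d) ℝ} {x y : Euc d}
    (hx : x ∈ (matKer P)ᗮ) (hy : y ∈ (matKer P)ᗮ)
    (h : Matrix.toEuclideanLin P x = Matrix.toEuclideanLin P y) : x = y := by
  have h1 : x - y ∈ matKer P := by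
    rw [matKer, LinearMap.mem_ker, map_sub, h, sub_self]
  have h2 : x - y ∈ matKer P ⊓ (matKer P)ᗮ := ⟨h1, Submodule.sub_mem _ hx hy⟩
  rw [Submodule.inf_orthogonal_eq_bot] at h2
  exact sub_eq_zero.1 ((Submodule.mem_bot ℝ).1 h2)

/-- The compression of a matrix to the orthogonal complement of a subspace. -/
noncomputable def compressOrthogonal (K : Submodule ℝ (Euc d)) (A : Matrix (Fin d) (Fin d) ℝ) :
    Kᗮ →ₗ[ℝ] Kᗮ :=
  (Kᗮ.orthogonalProjectionOnto : Euc d →ₗ[ℝ] Kᗮ) ∘ₗ Matrix.toEuclideanLin A ∘ₗ Kᗮ.subtype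

/-- A symmetric map that kills `K` has range in `Kᗮ`, so the projection in the compression does
nothing. -/
theorem coe_compressOrthogonal {K : Submodule ℝ (Euc d)} {A : Matrix (Fin d) (Fin d) ℝ}
    (hA : A.IsSymm) (hK : K ≤ matKer A) (y : Kᗮ) :
    (compressOrthogonal K A y : Euc d) = Matrix.toEuclideanLin A y := by
  have h := toEuclideanLin_mem_orthogonal hA hK y
  simp only [compressOrthogonal, LinearMap.comp_apply, Submodule.subtype_apply,
    ContinuousLinearMap.coe_coe]
  rw [← Submodule.starProjection_apply, Submodule.starProjection_eq_self_iff.2 h]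

theorem isSymmetric_compressOrthogonal {K : Submodule ℝ (Euc d)} {A : Matrix (Fin d) (Fin d) ℝ}
    (hA : A.IsSymm) (hK : K ≤ matKer A) : (compressOrthogonal K A).IsSymmetric := by
  intro x y
  rw [Submodule.coe_inner, Submodule.coe_inner, coe_compressOrthogonal hA hK,
    coe_compressOrthogonal hA hK, hA.isSymmetric_toEuclideanLin]

theorem quadForm_add {K : Submodule ℝ (Euc d)} {A : Matrix (Fin d) (Fin d) ℝ}
    (hA : A.IsSymm) (hK : K ≤ matKer A) (z : K) (y : Kᗮ) :
    quadForm A ((z : Euc d) + y) = inner ℝ (compressOrthogonal K A y) y := by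
  have h0 : Matrix.toEuclideanLin A z = 0 := hK z.2
  rw [Submodule.coe_inner, coe_compressOrthogonal hA hK, quadForm, map_add, h0, zero_add,
    inner_add_right, hA.isSymmetric_toEuclideanLin, h0, inner_zero_right, zero_add]

theorem quadForm_eq_inner_compress {K : Submodule ℝ (Euc d)} {A : Matrix (Fin d) (Fin d) ℝ}
    (hA : A.IsSymm) (hK : K ≤ matKer A) (x : Euc d) :
    quadForm A x = inner ℝ (compressOrthogonal K A (Kᗮ.orthogonalProjectionOnto x))
      (Kᗮ.orthogonalProjectionOnto x) := by
  rw [← quadForm_add hA hK (K.orthogonalProjectionOnto x)]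
  congr 1
  simpa only [orthogonalSplit_apply, orthogonalSplit_symm_apply] using
    ((orthogonalSplit K).symm_apply_apply x).symm

/-- A semidefinite form vanishes only on the kernel of its matrix, and `Kᗮ` meets that kernel
trivially. -/
theorem compressOrthogonal_pos {P M : Matrix (Fin d) (Fin d) ℝ} (hM : M.PosSemidef)
    (hk : matKer M = matKer P) (y : ((matKer P)ᗮ : Submodule ℝ (Euc d))) (hy : y ≠ 0) :
    0 < inner ℝ (compressOrthogonal (matKer P) M y) y := by
  rw [Submodule.coe_inner, coe_compressOrthogonal hM.isSymm_real hk.ge]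
  by_contra hle
  have h0 := hM.toEuclideanLin_eq_zero (x := (y : Euc d)) (not_lt.1 hle)
  have h2 : (y : Euc d) ∈ (matKer M)ᗮ := by rw [hk]; exact y.2
  exact hy (Subtype.ext (eq_of_mem_orthogonal_matKer h2 (Submodule.zero_mem _)
    (h0.trans (map_zero _).symm)))

/-- With the companion identity, this makes `P` invertible on `Kᗮ`, which is what reduces the slices
to the nondegenerate case. -/
theorem compressOrthogonal_moorePenrose_left {P : Matrix (Fin d) (Fin d) ℝ} (hP : P.IsSymm)
    (y : ((matKer P)ᗮ : Submodule ℝ (Euc d))) :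
    compressOrthogonal (matKer P) (moorePenrose P) (compressOrthogonal (matKer P) P y) = y := by
  apply Subtype.ext
  rw [coe_compressOrthogonal (moorePenrose_isSymm hP) (matKer_le_matKer_moorePenrose hP),
    coe_compressOrthogonal hP le_rfl]
  refine eq_of_mem_orthogonal_matKer (P := P) (toEuclideanLin_mem_orthogonal
    (moorePenrose_isSymm hP) (matKer_le_matKer_moorePenrose hP) _) y.2 ?_
  rw [← toEuclideanLin_mul_apply, ← toEuclideanLin_mul_apply,
    (isMoorePenrose_moorePenrose P).mul_mul_self]

theorem compressOrthogonal_moorePenrose_right {P : Matrix (Fin d) (Fin d) ℝ} (hP : P.IsSymm)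
    (y : ((matKer P)ᗮ : Submodule ℝ (Euc d))) :
    compressOrthogonal (matKer P) P (compressOrthogonal (matKer P) (moorePenrose P) y) = y := by
  have h := congrArg Subtype.val (compressOrthogonal_moorePenrose_left hP y)
  rw [coe_compressOrthogonal (moorePenrose_isSymm hP) (matKer_le_matKer_moorePenrose hP),
    coe_compressOrthogonal hP le_rfl] at h
  apply Subtype.ext
  rwa [coe_compressOrthogonal hP le_rfl,
    coe_compressOrthogonal (moorePenrose_isSymm hP) (matKer_le_matKer_moorePenrose hP),
    ← toEuclideanLin_mul_apply, ← moorePenrose_mul_comm hP, toEuclideanLin_mul_apply]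

end Matrices

/-! ### Reduction of a degenerate `P` to its slices. -/

section Degenerate

variable {d : ℕ}

/-- On a fixed slice `α z` is a constant, finite for almost every `z`, and the quadratic form sees
only the component in `Kᗮ`. -/
theorem DirectionalGaussianBound.ae_slice {K : Submodule ℝ (Euc d)}
    {M : Matrix (Fin d) (Fin d) ℝ} (hM : M.IsSymm) (hK : K ≤ matKer M) {g : Euc d → ℂ}
    (h : DirectionalGaussianBound K M g) :
    ∀ᵐ z : K, ∃ C : ℝ, ∀ᵐ y : Kᗮ, ‖g ((z : Euc d) + y)‖ ≤
      C * Real.exp (-Real.pi * inner ℝ (compressOrthogonal K M y) y) := by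
  obtain ⟨α, -, hfin, hb⟩ := h
  filter_upwards [hfin, ae_ae_orthogonal_add (K := K) hb] with z hz hzb
  refine ⟨(α z).toReal, ?_⟩
  filter_upwards [hzb] with y hy
  rw [projectionOnto_add_of_mem, quadForm_add hM hK, ← ENNReal.ofReal_toReal hz.ne,
    ← ENNReal.ofReal_mul ENNReal.toReal_nonneg, ← ofReal_norm] at hy
  exact (ENNReal.ofReal_le_ofReal_iff (by positivity)).1 hy

/-- The symbol depends only on the `Kᗮ` component of the frequency, so the adjoint multiplier
changes `φ` into `ψ` and leaves `χ` untouched. -/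
theorem integral_orthogonalTensor_metMultiplier {P : Matrix (Fin d) (Fin d) ℝ} (hP : P.IsSymm)
    {φ ψ : ((matKer P)ᗮ : Submodule ℝ (Euc d)) → ℂ} (hφ : Integrable φ) (hφ2 : MemLp φ 2)
    (hψ : Integrable ψ) (hψ2 : MemLp ψ 2)
    (hφψ : ∀ ξ, 𝓕 ψ ξ = Complex.exp (Complex.I * Real.pi *
      (inner ℝ (compressOrthogonal (matKer P) P ξ) ξ : ℝ)) * 𝓕 φ ξ)
    {χ : matKer P → ℂ} (hχ : Integrable χ) (hχ2 : MemLp χ 2) (f : L2Euc d) :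
    ∫ x, star (orthogonalTensor χ φ x) * metMultiplier P f x =
      ∫ x, star (orthogonalTensor χ ψ x) * f x := by
  have h := inner_metMultiplier (P := P) (φ := (memLp_orthogonalTensor hχ2 hφ2).toLp _)
    (ψ := (memLp_orthogonalTensor hχ2 hψ2).toLp _) ?_ f
  · rw [L2.inner_def, L2.inner_def] at h
    refine Eq.trans (integral_congr_ae ?_) (h.trans (integral_congr_ae ?_))
    · filter_upwards [(memLp_orthogonalTensor hχ2 hφ2).coeFn_toLp] with x hx
      rw [hx, RCLike.inner_apply, mul_comm]
      rfl
    · filter_upwards [(memLp_orthogonalTensor hχ2 hψ2).coeFn_toLp] with x hx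
      rw [hx, RCLike.inner_apply, mul_comm]
      rfl
  · filter_upwards [coeFn_fourier_toLp (integrable_orthogonalTensor hχ hφ)
        (memLp_orthogonalTensor hχ2 hφ2),
      coeFn_fourier_toLp (integrable_orthogonalTensor hχ hψ)
        (memLp_orthogonalTensor hχ2 hψ2)] with ξ h1 h2
    rw [h1, h2, fourier_orthogonalTensor, fourier_orthogonalTensor, hφψ, chirp,
      quadForm_eq_inner_compress hP le_rfl]
    ring

/-- For almost every slice, the Fourier transform of the chirped slice inherits the Gaussian decay
of the multiplier. -/
theorem ae_slice_fourier_decay {P M N : Matrix (Fin d) (Fin d) ℝ} (hP : P.IsSymm)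
    (hM : M.PosSemidef) (hN : N.PosSemidef) (hkerM : matKer M = matKer P)
    (hkerN : matKer N = matKer P) (f : L2Euc d)
    (hbound : DirectionalGaussianBound (matKer P) M f)
    (hbound' : DirectionalGaussianBound (matKer P) N (metMultiplier P f)) :
    ∀ᵐ z : matKer P,
      (∃ C : ℝ, ∀ᵐ y : ((matKer P)ᗮ : Submodule ℝ (Euc d)), ‖f ((z : Euc d) + y)‖ ≤
        C * Real.exp (-Real.pi * inner ℝ (compressOrthogonal (matKer P) M y) y)) ∧
      ∃ C : ℝ, ∀ ζ, ‖𝓕 (fun y : ((matKer P)ᗮ : Submodule ℝ (Euc d)) =>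
          Complex.exp (Complex.I * Real.pi *
            (inner ℝ (compressOrthogonal (matKer P) (moorePenrose P) y) y : ℝ)) *
          f ((z : Euc d) + y)) ζ‖ ≤
        C * Real.exp (-Real.pi * inner ℝ ((compressOrthogonal (matKer P) P ∘ₗ
          compressOrthogonal (matKer P) N ∘ₗ compressOrthogonal (matKer P) P) ζ) ζ) := by
  set K := matKer P
  set A := compressOrthogonal K P
  set S := compressOrthogonal K (moorePenrose P)
  have hA : A.IsSymmetric := isSymmetric_compressOrthogonal hP le_rfl
  have hS : S.IsSymmetric := isSymmetric_compressOrthogonal (moorePenrose_isSymm hP)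
    (matKer_le_matKer_moorePenrose hP)
  have hAS : ∀ y, A (S y) = y := compressOrthogonal_moorePenrose_right hP
  have hSA : ∀ y, S (A y) = y := compressOrthogonal_moorePenrose_left hP
  obtain ⟨c, hc, hcF⟩ := exists_fourier_chirpGaussian hA hAS hSA
  have hpair : ∀ w : Kᗮ, ∀ᵐ z : K,
      ∫ y, star (chirpGaussian S w y) * metMultiplier P f ((z : Euc d) + y) =
        ∫ y, star (c * chirpGaussianImage S w y) * f ((z : Euc d) + y) := by
    intro w
    have hφb : ∀ᵐ y, ‖chirpGaussian S w y‖ ≤ 1 * Real.exp (-Real.pi * ‖y‖ ^ 2) :=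
      Filter.Eventually.of_forall fun y => by rw [norm_chirpGaussian, one_mul]
    obtain ⟨C, δ, hδ, hψb⟩ := exists_chirpGaussianImage_le hAS w
    have hφm := (continuous_chirpGaussian S w).aestronglyMeasurable (μ := volume)
    have hψm := (continuous_chirpGaussianImage S w).aestronglyMeasurable (μ := volume)
    have hψi := integrable_of_gaussian_bound hψm hδ (Filter.Eventually.of_forall hψb)
    have hψ2 := memLp_two_of_gaussian_bound hψm hδ (Filter.Eventually.of_forall hψb)
    have hφi := integrable_of_gaussian_bound hφm Real.pi_pos hφb
    have hφ2 := memLp_two_of_gaussian_bound hφm Real.pi_pos hφb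
    refine ae_slice_pairing_eq (Lp.memLp _) (Lp.memLp _) hφ2 (hψ2.const_mul c) fun χ hχ hχ2 =>
      integral_orthogonalTensor_metMultiplier hP hφi hφ2 (hψi.const_mul c) (hψ2.const_mul c)
        (fun ξ => ?_) hχ hχ2 f
    rw [← hcF, Real.fourier_eq', Real.fourier_eq', ← integral_const_mul]
    refine integral_congr_ae (Filter.Eventually.of_forall fun y => ?_)
    simp only [smul_eq_mul]
    ring
  -- The exceptional null set in `hpair` depends on `w`; restricting to a dense sequence of
  -- frequencies gives one null set for all.
  have hpair' : ∀ᵐ z : K, ∀ n : ℕ,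
      ∫ y, star (chirpGaussian S (TopologicalSpace.denseSeq Kᗮ n) y) *
          metMultiplier P f ((z : Euc d) + y) =
        ∫ y, star (c * chirpGaussianImage S (TopologicalSpace.denseSeq Kᗮ n) y) *
          f ((z : Euc d) + y) := ae_all_iff.2 fun n => hpair _
  obtain ⟨m, hm, hMm⟩ := exists_coercive (isSymmetric_compressOrthogonal hM.isSymm_real hkerM.ge)
    (compressOrthogonal_pos hM hkerM)
  obtain ⟨n, hn, hNn⟩ := exists_coercive (isSymmetric_compressOrthogonal hN.isSymm_real hkerN.ge)
    (compressOrthogonal_pos hN hkerN)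
  have hadd : ∀ z : K, Measurable fun y : Kᗮ => (z : Euc d) + y := fun z => by fun_prop
  have hint : ∀ (z : K) (u : L2Euc d) (T : Kᗮ →ₗ[ℝ] Kᗮ) (t : ℝ), 0 < t →
      (∀ y, t * ‖y‖ ^ 2 ≤ inner ℝ (T y) y) → ∀ C : ℝ,
      (∀ᵐ y : Kᗮ, ‖u ((z : Euc d) + y)‖ ≤ C * Real.exp (-Real.pi * inner ℝ (T y) y)) →
      Integrable fun y : Kᗮ => u ((z : Euc d) + y) := by
    intro z u T t ht hTt C hC
    have hC0 : 0 ≤ C := by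
      obtain ⟨y, hy⟩ := hC.exists
      exact nonneg_of_mul_nonneg_left ((norm_nonneg _).trans hy) (Real.exp_pos _)
    refine integrable_of_gaussian_bound
      ((Lp.stronglyMeasurable u).comp_measurable (hadd z)).aestronglyMeasurable
      (mul_pos Real.pi_pos ht) (C := C) ?_
    filter_upwards [hC] with y hy
    exact hy.trans (mul_le_mul_of_nonneg_left (exp_neg_inner_le_of_coercive hTt y) hC0)
  filter_upwards [hbound.ae_slice hM.isSymm_real hkerM.ge,
    hbound'.ae_slice hN.isSymm_real hkerN.ge, hpair'] with z ⟨C, hC⟩ ⟨C', hC'⟩ hz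
  refine ⟨⟨C, hC⟩, C' / ‖c‖, ?_⟩
  have hfi := hint z f _ m hm hMm C hC
  have hhi := hint z (metMultiplier P f) _ n hn hNn C' hC'
  have hae := ae_eq_fourier_comp_of_pairing hS hfi hhi c
    (TopologicalSpace.denseRange_denseSeq Kᗮ) (by rintro _ ⟨k, rfl⟩; exact hz k)
  set g : Kᗮ → ℂ := fun y => Complex.exp (Complex.I * Real.pi * (inner ℝ (S y) y : ℝ)) *
    f ((z : Euc d) + y)
  have hqc := continuous_inner_map_self S
  have hg : Integrable g := by
    refine hfi.norm.mono' (AEStronglyMeasurable.mul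
      (by fun_prop : Continuous _).aestronglyMeasurable hfi.1)
      (Filter.Eventually.of_forall fun x => ?_)
    rw [norm_mul, norm_cexp_I_pi_mul, one_mul]
  have hle : ∀ᵐ y : Kᗮ, ‖c‖ * ‖𝓕 g (S y)‖ ≤
      C' * Real.exp (-Real.pi * inner ℝ (compressOrthogonal K N y) y) := by
    filter_upwards [hae, hC'] with y hy1 hy2
    rw [← norm_star c, ← norm_mul, ← hy1, norm_mul, norm_cexp_neg_I_pi_mul, one_mul]
    exact hy2
  have hGc := continuous_fourier hg
  have hSc := S.continuous_of_finiteDimensional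
  have hNc := continuous_inner_map_self (compressOrthogonal K N)
  -- Continuity upgrades the almost everywhere bound to every point, as the arguments on lines,
  -- which are null sets in higher dimension, require.
  have hclosed : IsClosed {y : Kᗮ | ‖c‖ * ‖𝓕 g (S y)‖ ≤
      C' * Real.exp (-Real.pi * inner ℝ (compressOrthogonal K N y) y)} :=
    isClosed_le (by fun_prop) (by fun_prop)
  have hall : ∀ y : Kᗮ, ‖c‖ * ‖𝓕 g (S y)‖ ≤
      C' * Real.exp (-Real.pi * inner ℝ (compressOrthogonal K N y) y) := fun y =>
    hclosed.closure_subset (Measure.dense_of_ae hle y)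
  intro ζ
  -- At `y = Aζ` one has `S y = ζ`, and the form of `N` at `Aζ` is that of `A N A` at `ζ`.
  have h1 := hall (A ζ)
  rw [hSA] at h1
  rw [LinearMap.comp_apply, LinearMap.comp_apply, hA, div_mul_eq_mul_div,
    le_div_iff₀ (norm_pos_iff.2 hc), mul_comm]
  exact h1

theorem measurableSet_slice_eq {K : Submodule ℝ (Euc d)} (f : L2Euc d) {u : K × Kᗮ → ℂ}
    (hu : StronglyMeasurable u) :
    MeasurableSet {p : K × Kᗮ | f ((p.1 : Euc d) + p.2) = u p} := by
  have h1 : StronglyMeasurable fun p : K × Kᗮ => f ((p.1 : Euc d) + p.2) :=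
    (Lp.stronglyMeasurable f).comp_measurable (by fun_prop)
  exact measurableSet_eq_fun h1.measurable hu.measurable

/-- By Fubini some slice in `y` is square integrable, and there the nonzero constant `b y` can be
divided out. -/
theorem memLp_left_of_mul {X Y : Type*} [MeasurableSpace X] [MeasurableSpace Y] {μ : Measure X}
    {ν : Measure Y} [SFinite μ] [SFinite ν] [NeZero ν] {a : X → ℂ} {b : Y → ℂ}
    (ha : AEStronglyMeasurable a μ) (hb : ∀ y, b y ≠ 0)
    (h : MemLp (fun p : X × Y => a p.1 * b p.2) 2 (μ.prod ν)) : MemLp a 2 μ := by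
  rw [memLp_two_iff_integrable_sq_norm ha]
  have h1 := ((memLp_two_iff_integrable_sq_norm h.1).1 h).prod_left_ae
  obtain ⟨y, hy⟩ := h1.exists
  have := hy.mul_const ((‖b y‖ ^ 2)⁻¹)
  refine this.congr (Filter.Eventually.of_forall fun x => ?_)
  have h2 := norm_ne_zero_iff.2 (hb y)
  simp only [norm_mul]
  field_simp

theorem ae_of_ae_prod_orthogonal_add {K : Submodule ℝ (Euc d)} {p : Euc d → Prop}
    (h : ∀ᵐ q ∂(volume.prod volume : Measure (K × Kᗮ)), p ((q.1 : Euc d) + q.2)) :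
    ∀ᵐ x, p x := by
  filter_upwards [ae_of_ae_orthogonal_add h] with x hx
  have hxx := (orthogonalSplit K).symm_apply_apply x
  rw [orthogonalSplit_apply, orthogonalSplit_symm_apply] at hxx
  rwa [← hxx]

theorem exists_Lp_of_ae_prod_eq {K : Submodule ℝ (Euc d)} (f : L2Euc d) {γ : K → ℂ}
    (hγ : AEStronglyMeasurable γ volume) {e : Kᗮ → ℂ} (he : ∀ y, e y ≠ 0)
    (h : ∀ᵐ p ∂(volume.prod volume : Measure (K × Kᗮ)),
      f ((p.1 : Euc d) + p.2) = γ p.1 * e p.2) :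
    ∃ Γ : Lp (α := K) ℂ 2 (volume : Measure K), ∀ᵐ x : Euc d,
      f x = Γ (K.orthogonalProjectionOnto x) * e (Kᗮ.orthogonalProjectionOnto x) := by
  have hγ2 : MemLp γ 2 volume := memLp_left_of_mul (ν := (volume : Measure Kᗮ)) hγ he
    (((Lp.memLp f).comp_measurePreserving (measurePreserving_orthogonal_add K)).ae_eq h)
  have h1 : ∀ᵐ z : K, hγ2.toLp γ z = γ z := hγ2.coeFn_toLp
  have h2 : ∀ᵐ p ∂(volume.prod volume : Measure (K × Kᗮ)), hγ2.toLp γ p.1 = γ p.1 :=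
    (Measure.quasiMeasurePreserving_fst (μ := (volume : Measure K))
      (ν := (volume : Measure Kᗮ))).ae h1
  refine ⟨hγ2.toLp γ, ae_of_ae_prod_orthogonal_add (K := K) ?_⟩
  filter_upwards [h, h2] with p hp1 hp2
  rw [projectionOnto_add_of_mem, projectionOnto_orthogonal_add_of_mem, hp1, hp2]

end Degenerate

/-! ### The eigenvalue bound and the rigidity statement. -/

theorem mainTheorem8 {d : ℕ} (P M N : Matrix (Fin d) (Fin d) ℝ)
    (hP : P.IsSymm) (hP0 : P ≠ 0)
    (hM : M.PosSemidef) (hN : N.PosSemidef)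
    (hkerM : matKer M = matKer P) (hkerN : matKer N = matKer P)
    (f : L2Euc d) (hf : f ≠ 0)
    (hbound : DirectionalGaussianBound (matKer P) M f)
    (hbound' : DirectionalGaussianBound (matKer P) N (metMultiplier P f)) :
    (∀ μ : ℝ, 0 < μ →
      Module.End.HasEigenvalue (Matrix.toEuclideanLin (M * P * N * P)) μ → μ ≤ 1) ∧
    ((∀ μ : ℝ, 0 < μ →
      Module.End.HasEigenvalue (Matrix.toEuclideanLin (M * P * N * P)) μ → μ = 1) →
      ∃ γ : Lp (α := matKer P) ℂ 2 (volume : Measure (matKer P)),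
        ∀ᵐ x ∂(volume : Measure (Euc d)),
          f x = γ ((matKer P).orthogonalProjectionOnto x) *
            Complex.exp (-(Real.pi : ℂ) *
              ((quadForm M x : ℂ) + Complex.I * (quadForm (moorePenrose P) x : ℂ)))) := by
  have hslice := ae_slice_fourier_decay hP hM hN hkerM hkerN f hbound hbound'
  have hX := moorePenrose_isSymm hP
  have hXk := matKer_le_matKer_moorePenrose hP
  have hMs := hM.isSymm_real
  have hNs := hN.isSymm_real
  set K := matKer P
  set A := compressOrthogonal K P with hAdef
  set S := compressOrthogonal K (moorePenrose P)
  set M' := compressOrthogonal K M with hM'def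
  set N' := compressOrthogonal K N with hN'def
  have hA : A.IsSymmetric := isSymmetric_compressOrthogonal hP le_rfl
  have hM' : M'.IsSymmetric := isSymmetric_compressOrthogonal hMs hkerM.ge
  have hN' : N'.IsSymmetric := isSymmetric_compressOrthogonal hNs hkerN.ge
  set B := A ∘ₗ N' ∘ₗ A with hBdef
  have hB : B.IsSymmetric := fun x y => by
    simp only [hBdef, LinearMap.comp_apply]
    rw [hA, hN', hA]
  have hcoeB : ∀ y : Kᗮ, (B y : Euc d) = Matrix.toEuclideanLin (P * N * P) y := fun y => by
    simp only [hBdef, LinearMap.comp_apply, hAdef, hN'def]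
    rw [coe_compressOrthogonal hP le_rfl, coe_compressOrthogonal hNs hkerN.ge,
      coe_compressOrthogonal hP le_rfl, toEuclideanLin_mul_apply, toEuclideanLin_mul_apply]
  have hcoeM : ∀ y : Kᗮ, (M' y : Euc d) = Matrix.toEuclideanLin M y :=
    coe_compressOrthogonal hMs hkerM.ge
  have hM'pos := compressOrthogonal_pos hM hkerM
  obtain ⟨m, hm, hMm⟩ := exists_coercive hM' hM'pos
  have hqc := continuous_inner_map_self S
  have hMc := continuous_inner_map_self M'
  set G : K → Kᗮ → ℂ := fun z y =>
    Complex.exp (Complex.I * Real.pi * (inner ℝ (S y) y : ℝ)) * f ((z : Euc d) + y) with hGdef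
  have hadd : Measurable fun p : K × Kᗮ => (p.1 : Euc d) + p.2 := by fun_prop
  have hGm2 : StronglyMeasurable fun p : K × Kᗮ => G p.1 p.2 :=
    StronglyMeasurable.mul (by fun_prop : Continuous _).stronglyMeasurable
      ((Lp.stronglyMeasurable f).comp_measurable hadd)
  have hGm : ∀ z, AEStronglyMeasurable (G z) volume := fun z =>
    (hGm2.comp_measurable measurable_prodMk_left).aestronglyMeasurable
  have hGb : ∀ (z : K) (C : ℝ), (∀ᵐ y : Kᗮ, ‖f ((z : Euc d) + y)‖ ≤
      C * Real.exp (-Real.pi * inner ℝ (M' y) y)) →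
      ∀ᵐ y : Kᗮ, ‖G z y‖ ≤ C * Real.exp (-Real.pi * inner ℝ (M' y) y) := fun z C h => by
    filter_upwards [h] with y hy
    rw [hGdef, norm_mul, norm_cexp_I_pi_mul, one_mul]
    exact hy
  have hfG : ∀ (z : K) (y : Kᗮ), f ((z : Euc d) + y) =
      Complex.exp (-Complex.I * Real.pi * (inner ℝ (S y) y : ℝ)) * G z y := fun z y => by
    rw [hGdef, ← mul_assoc, ← Complex.exp_add]
    simp
  constructor
  · intro μ hμ heig
    by_contra hlt
    rw [not_le] at hlt
    obtain ⟨v, hv⟩ := heig.exists_hasEigenvector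
    have hv1 : Matrix.toEuclideanLin M (Matrix.toEuclideanLin (P * N * P) v) = μ • v := by
      rw [← toEuclideanLin_mul_apply, ← hv.apply_eq_smul]
      simp only [Matrix.mul_assoc]
    have hPNP : Matrix.toEuclideanLin (P * N * P) v ∈ Kᗮ := by
      rw [Matrix.mul_assoc, toEuclideanLin_mul_apply]
      exact toEuclideanLin_mem_orthogonal hP le_rfl _
    -- For an eigenvector `v` of `M(PNP)`, this choice gives `Mu = v` and hence `B(Mu) = μu`, the
    -- input of the supercritical Hardy principle.
    set u : Kᗮ := μ⁻¹ • ⟨_, hPNP⟩ with hu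
    have hMu : (M' u : Euc d) = v := by
      rw [hcoeM, hu, Submodule.coe_smul, map_smul, hv1, inv_smul_smul₀ hμ.ne']
    have hu0 : u ≠ 0 := fun h0 => hv.2 (by rw [← hMu, h0, map_zero]; rfl)
    have hBM : B (M' u) = μ • u := by
      apply Subtype.ext
      rw [hcoeB, hMu, hu, smul_inv_smul₀ hμ.ne']
    have hzero : ∀ᵐ p ∂(volume.prod volume : Measure (K × Kᗮ)),
        f ((p.1 : Euc d) + p.2) = 0 := by
      rw [Measure.ae_prod_iff_ae_ae (measurableSet_slice_eq f stronglyMeasurable_const)]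
      filter_upwards [hslice] with z ⟨⟨C, hC⟩, C', hC'⟩
      have hF := ae_eq_zero_of_hardy hM' hB (hGm z) hm hMm (hGb z C hC) hC' hu0 hlt hBM
      have hGi : Integrable (G z) := integrable_of_gaussian_bound (hGm z) (mul_pos Real.pi_pos hm)
        (C := C) (by
          filter_upwards [hGb z C hC] with y hy
          have hC0 := nonneg_of_mul_nonneg_left ((norm_nonneg _).trans hy) (Real.exp_pos _)
          exact hy.trans (mul_le_mul_of_nonneg_left (exp_neg_inner_le_of_coercive hMm y) hC0))
      filter_upwards [ae_eq_zero_of_fourier_eq_zero hGi hF] with y hy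
      rw [hfG, hy, Pi.zero_apply, mul_zero]
    refine hf (Lp.eq_zero_iff_ae_eq_zero.2 ?_)
    exact ae_of_ae_prod_orthogonal_add hzero
  · intro heig
    have hPNP : (P * N * P).PosSemidef := by
      have := hN.mul_mul_conjTranspose_same P
      rwa [Matrix.conjTranspose_eq_transpose_of_trivial, hP.eq] at this
    have hid := mul_mul_eq_of_eigenvalues hM hPNP (fun μ hμ he => heig μ hμ (by
      simpa only [Matrix.mul_assoc] using he))
    have hM'inj : ∀ x y, M' x = M' y → x = y := fun x y hxy => by
      by_contra hne
      have := hM'pos (x - y) (sub_ne_zero.2 hne)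
      rw [← hM'def, map_sub, hxy, sub_self, inner_zero_left] at this
      exact lt_irrefl _ this
    have hMBM : ∀ y, M' (B (M' (B (M' y)))) = M' (B (M' y)) := fun y => by
      apply Subtype.ext
      simp only [hcoeM, hcoeB, ← toEuclideanLin_mul_apply]
      have := congrArg (fun X => Matrix.toEuclideanLin X (y : Euc d)) hid
      simpa only [Matrix.mul_assoc] using this
    have hN'pos := compressOrthogonal_pos hN hkerN
    have hBinj : ∀ x y, B x = B y → x = y := fun x y hxy => by
      have hSA := compressOrthogonal_moorePenrose_left hP
      by_contra hne
      have h1 : A (x - y) ≠ 0 := fun h0 => sub_ne_zero.2 hne (by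
        rw [← hSA (x - y), ← hAdef, h0, map_zero])
      have h2 := hN'pos _ h1
      rw [← hN'def, ← hA] at h2
      have h3 : A (N' (A (x - y))) = B (x - y) := rfl
      rw [h3, map_sub, hxy, sub_self, inner_zero_left] at h2
      exact lt_irrefl _ h2
    -- `M'` and `B` are injective on `Kᗮ`, so `M'`, `B`, `M'` cancel in turn from `M'BM'BM' =
    -- M'BM'`.
    have hBM : ∀ u, B (M' u) = u := fun u =>
      hM'inj _ _ (hBinj _ _ (hM'inj _ _ (hMBM u)))
    obtain ⟨κ, hκ, hκM⟩ := exists_fourier_gaussian hM' hM'pos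
    -- This is the Hardy constant `𝓕 (G z) 0 / κ`, written as an integral so that its measurability
    -- in `z` follows from joint measurability.
    set γ : K → ℂ := fun z => (∫ y, G z y) / κ with hγ
    have hγm : StronglyMeasurable γ := by
      have := (hGm2.integral_prod_right' (ν := volume)).mul_const κ⁻¹
      simpa only [hγ, div_eq_mul_inv] using this
    set e : Kᗮ → ℂ := fun y => Complex.exp (-(Real.pi : ℂ) * (((inner ℝ (M' y) y : ℝ) : ℂ) +
      Complex.I * ((inner ℝ (S y) y : ℝ) : ℂ))) with he
    have hec : Continuous e := by fun_prop
    have he0 : ∀ y, e y ≠ 0 := fun y => Complex.exp_ne_zero _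
    have hprod : ∀ᵐ p ∂(volume.prod volume : Measure (K × Kᗮ)),
        f ((p.1 : Euc d) + p.2) = γ p.1 * e p.2 := by
      have hm2 : StronglyMeasurable fun p : K × Kᗮ => γ p.1 * e p.2 :=
        (hγm.comp_measurable measurable_fst).mul
          (hec.stronglyMeasurable.comp_measurable measurable_snd)
      rw [Measure.ae_prod_iff_ae_ae (measurableSet_slice_eq f hm2)]
      filter_upwards [hslice] with z ⟨⟨C, hC⟩, C', hC'⟩
      filter_upwards [ae_eq_gaussian_of_hardy hM' hκ hκM (hGm z) hm hMm (hGb z C hC) hC' hBM]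
        with y hy
      have h0 : 𝓕 (G z) 0 = ∫ y, G z y := by
        rw [Real.fourier_eq']
        simp
      rw [hfG, hy, h0, hγ, he]
      simp only
      rw [mul_left_comm, ← Complex.exp_add]
      congr 2
      ring
    obtain ⟨Γ, hΓ⟩ := exists_Lp_of_ae_prod_eq f hγm.aestronglyMeasurable
      he0 hprod
    refine ⟨Γ, ?_⟩
    filter_upwards [hΓ] with x hx
    have h1 : quadForm M x = inner ℝ (M' (Kᗮ.orthogonalProjectionOnto x))
        (Kᗮ.orthogonalProjectionOnto x) := quadForm_eq_inner_compress hMs hkerM.ge x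
    have h2 : quadForm (moorePenrose P) x = inner ℝ (S (Kᗮ.orthogonalProjectionOnto x))
        (Kᗮ.orthogonalProjectionOnto x) := quadForm_eq_inner_compress hX hXk x
    rw [h1, h2]
    exact hx
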